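/- Alice holds a matrix $A\in\mathbb{R}^{m\times n}$ and Bob holds a vector $b\in\mathbb{R}^m$, where $m,n\ge 1$. Under some public encoding every entry of $A$ and $b$ is specified by $O(\log(mn))$ bits, i.e. by at most $c\,(1+\log(mn))$ bits for a fixed constant $c$, and $A^+b\neq 0$. Here $A^+$ is the Moore–Penrose pseudoinverse, $\|\cdot\|$ is the Euclidean norm of vectors and the operator norm (largest singular value) of matrices, $\|\cdot\|_F$ is the Frobenius norm, and $|A^+b\rangle=A^+b/\|A^+b\|$. In a quantum protocol (without prior entanglement) the parties alternately apply unitaries, each depending on the party's own input only, to their private memory and a message register of qubits that is then sent to the other party. The receiver of the last message finally outputs an $n$-dimensional register, and the cost is the total number of qubits sent. If the communication is one-way, messages go in the prescribed direction only and the receiver outputs; if it is two-way, messages go in both directions and either party may be the one that outputs. For a set of inputs, the quantum communication complexity of outputting $|A^+b\rangle$ with error $\varepsilon$ is the least cost of a protocol whose output is, for every input $(A,b)$ in the set, within trace distance $\varepsilon$ of $|A^+b\rangle$. Then for all $c$ and all $\varepsilon>0$ there is a constant $C=C(c,\varepsilon)>0$ such that for all $m,n\ge1$, all public encodings as above and all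 $K\ge 1$ (an upper bound, known to both parties, on the relevant ratio): 1. if the communication is one-way from Bob to Alice, the quantum communication complexity on the inputs with $\|A^+\|^2\|b\|^2/\|A^+b\|^2\le K$ is at most $C\min\{K\log m,\; m\log(mn)\}$; 2. if the communication is one-way from Alice to Bob, the quantum communication complexity on the inputs with $\|A^+\|_F^2\|b\|^2/\|A^+b\|^2\le K$ is at most $C\min\{K\log(mn),\; mn\log(mn)\}$; 3. if the communication is two-way, the quantum communication complexity on the inputs with $\|A^+\|\|b\|/\|A^+b\|\le K$ is at most $C\min\{K\log m,\; m\log(mn)\}$. -/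

import Mathlib

open scoped ENNReal

noncomputable section

namespace QRegression

/-! ### Linear algebra -/

/-- The Moore-Penrose pseudoinverse `(AᵀA)⁺ Aᵀ` of a real matrix, where `(AᵀA)⁺` is obtained by
inverting the nonzero eigenvalues of `AᵀA` (in Lean `0⁻¹ = 0`). If `A = ∑ σ_i |u_i⟩⟨v_i|` is a
singular value decomposition, this is `∑ σ_i⁻¹ |v_i⟩⟨u_i|`. -/
def pinv {m n : ℕ} (A : Matrix (Fin m) (Fin n) ℝ) : Matrix (Fin n) (Fin m) ℝ :=
  let hA := Matrix.isHermitian_conjTranspose_mul_self A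
  (hA.eigenvectorUnitary : Matrix (Fin n) (Fin n) ℝ)
    * Matrix.diagonal (fun i => (hA.eigenvalues i)⁻¹)
    * (hA.eigenvectorUnitary : Matrix (Fin n) (Fin n) ℝ).conjTranspose * A.conjTranspose

/-- The four Penrose equations, which determine the pseudoinverse. -/
theorem pinv_penrose {m n : ℕ} (A : Matrix (Fin m) (Fin n) ℝ) :
    A * pinv A * A = A ∧ pinv A * A * pinv A = pinv A ∧
      (A * pinv A).transpose = A * pinv A ∧ (pinv A * A).transpose = pinv A * A := by
  have hA := Matrix.isHermitian_conjTranspose_mul_self A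
  obtain ⟨G, hG, h1, h2, h3, h4⟩ : ∃ G : Matrix (Fin n) (Fin n) ℝ, pinv A = G * A.conjTranspose ∧
      (A.conjTranspose * A) * G * (A.conjTranspose * A) = A.conjTranspose * A ∧
      G * (A.conjTranspose * A) * G = G ∧ G * (A.conjTranspose * A) = (A.conjTranspose * A) * G ∧
      G.conjTranspose = G := by
    set U : Matrix (Fin n) (Fin n) ℝ := (hA.eigenvectorUnitary : Matrix (Fin n) (Fin n) ℝ) with hU
    have hUU : U.conjTranspose * U = 1 := Unitary.coe_star_mul_self hA.eigenvectorUnitary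
    have hs : A.conjTranspose * A = U * Matrix.diagonal hA.eigenvalues * U.conjTranspose := by
      have := hA.spectral_theorem
      rw [Unitary.conjStarAlgAut_apply] at this
      exact this
    have key : ∀ D E : Matrix (Fin n) (Fin n) ℝ,
        (U * D * U.conjTranspose) * (U * E * U.conjTranspose) = U * (D * E) * U.conjTranspose := by
      intro D E
      calc _ = U * D * (U.conjTranspose * U) * E * U.conjTranspose := by
            simp only [Matrix.mul_assoc]
        _ = _ := by rw [hUU]; simp only [Matrix.mul_one, Matrix.mul_assoc]
    refine ⟨U * Matrix.diagonal (fun i => (hA.eigenvalues i)⁻¹) * U.conjTranspose, rfl, ?_⟩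
    clear_value U
    generalize hA.eigenvalues = L at *
    clear hU hA
    rw [hs]
    simp only [key, Matrix.diagonal_mul_diagonal]
    refine ⟨?_, ?_, ?_, ?_⟩
    · simp only [mul_inv_mul_cancel]
    · congr 3
      funext i
      by_cases h : L i = 0 <;> simp [h]
    · simp only [mul_comm]
    · simp [Matrix.mul_assoc]
  have hT : ∀ {p q : ℕ} (M : Matrix (Fin p) (Fin q) ℝ), M.transpose = M.conjTranspose :=
    fun M => (Matrix.conjTranspose_eq_transpose_of_trivial M).symm
  simp only [hT, hG]
  refine ⟨?_, ?_, ?_, ?_⟩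
  · have hz : A * (G * A.conjTranspose) * A - A = 0 := by
      rw [← Matrix.conjTranspose_mul_self_eq_zero]
      have e : A * (G * A.conjTranspose) * A - A = A * (G * (A.conjTranspose * A) - 1) := by
        simp only [Matrix.mul_sub, Matrix.mul_assoc, Matrix.mul_one]
      have e2 : A.conjTranspose * (A * (G * (A.conjTranspose * A) - 1)) = 0 := by
        rw [← Matrix.mul_assoc, Matrix.mul_sub, ← Matrix.mul_assoc, h1, Matrix.mul_one, sub_self]
      rw [e, Matrix.conjTranspose_mul, Matrix.mul_assoc, e2, Matrix.mul_zero]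
    exact sub_eq_zero.mp hz
  · rw [Matrix.mul_assoc, Matrix.mul_assoc, ← Matrix.mul_assoc _ A, ← Matrix.mul_assoc _ G,
      ← Matrix.mul_assoc, ← Matrix.mul_assoc, h2]
  · simp only [Matrix.conjTranspose_mul, Matrix.conjTranspose_conjTranspose, h4, Matrix.mul_assoc]
  · rw [Matrix.mul_assoc]
    nth_rewrite 1 [h3]
    simp only [Matrix.conjTranspose_mul, Matrix.conjTranspose_conjTranspose, h4, Matrix.mul_assoc]

/-- Euclidean norm of a real vector. -/
def vecNorm {m : ℕ} (v : Fin m → ℝ) : ℝ := ‖WithLp.toLp 2 v‖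

/-- Operator norm (largest singular value) of a real matrix. -/
def opNorm {m n : ℕ} (M : Matrix (Fin m) (Fin n) ℝ) : ℝ :=
  ‖LinearMap.toContinuousLinearMap (Matrix.toEuclideanLin M)‖

/-- Frobenius norm of a real matrix. -/
def frobNorm {m n : ℕ} (M : Matrix (Fin m) (Fin n) ℝ) : ℝ :=
  Real.sqrt (∑ i, ∑ j, M i j ^ 2)

/-- The density matrix `|v⟩⟨v|` of the normalised state `|v⟩` of a nonzero vector `v`. -/
def pureState {n : ℕ} (v : Fin n → ℝ) : Matrix (Fin n) (Fin n) ℂ :=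
  fun i j => ((v i / vecNorm v * (v j / vecNorm v) : ℝ) : ℂ)

/-- Trace norm: the sum of the singular values. -/
def traceNorm {n : ℕ} (M : Matrix (Fin n) (Fin n) ℂ) : ℝ :=
  ∑ i, Real.sqrt ((Matrix.isHermitian_conjTranspose_mul_self M).eigenvalues i)

/-- Trace distance of two density matrices. -/
def traceDist {n : ℕ} (r s : Matrix (Fin n) (Fin n) ℂ) : ℝ := traceNorm (r - s) / 2

/-! ### Two-party quantum communication -/

/-- The two parties. -/
inductive Party : Type
  | alice
  | bob

/-- The other party. -/
def Party.other : Party → Party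
  | .alice => .bob
  | .bob => .alice

/-- Computational basis of a channel of `T` qubits. -/
abbrev Chan (T : ℕ) : Type := Fin T → Fin 2

/-- A two-party quantum communication protocol without prior entanglement. Alice gets an input in
`X`, Bob gets an input in `Y`, and one of them has to output a state of an `n`-dimensional system.

The global system is `(Alice's memory) ⊗ (channel) ⊗ (Bob's memory)`; the channel has `qubits`
qubits, and the memory of each party consists of an `n`-dimensional output register and a workspace
of arbitrary finite dimension. The system starts in a fixed product basis state that does not depend
on the inputs, with the channel in `|0…0⟩`. The parties act in turns, beginning with `first`: the
party whose turn it is applies a unitary, which may depend on its own input only, to its memory and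
the channel, and then sends the channel to the other party. After `messages` such messages the
party that holds the channel applies a last unitary and outputs its output register. -/
structure Protocol (X Y : Type) (n : ℕ) : Type 1 where
  WA : Type
  WB : Type
  [fintypeA : Fintype WA]
  [fintypeB : Fintype WB]
  [decEqA : DecidableEq WA]
  [decEqB : DecidableEq WB]
  qubits : ℕ
  messages : ℕ
  first : Party
  startA : Fin n × WA
  startB : Fin n × WB
  opA : ℕ → X → Matrix.unitaryGroup ((Fin n × WA) × Chan qubits) ℂ
  opB : ℕ → Y → Matrix.unitaryGroup ((Fin n × WB) × Chan qubits) ℂ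

namespace Protocol

attribute [instance] fintypeA fintypeB decEqA decEqB

variable {X Y : Type} {n : ℕ}

/-- Basis of Alice's memory. -/
abbrev MemA (P : Protocol X Y n) : Type := Fin n × P.WA

/-- Basis of Bob's memory. -/
abbrev MemB (P : Protocol X Y n) : Type := Fin n × P.WB

/-- The party whose turn it is in step `k`. -/
def actor (P : Protocol X Y n) (k : ℕ) : Party := if Even k then P.first else P.first.other

/-- The party that outputs: the receiver of the last message. -/
def outputParty (P : Protocol X Y n) : Party := P.actor P.messages

/-- The number of qubits communicated. -/
def cost (P : Protocol X Y n) : ℕ := P.messages * P.qubits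

/-- Amplitudes of the initial state. -/
def initial (P : Protocol X Y n) : P.MemA → Chan P.qubits → P.MemB → ℂ := fun a c b =>
  if a = P.startA ∧ c = 0 ∧ b = P.startB then 1 else 0

/-- Amplitudes of the global state after the first `k` local operations, on inputs `x`, `y`. -/
def state (P : Protocol X Y n) (x : X) (y : Y) : ℕ → P.MemA → Chan P.qubits → P.MemB → ℂ
  | 0 => P.initial
  | k + 1 => fun a c b =>
    match P.actor k with
    | .alice => ∑ p : P.MemA × Chan P.qubits,
        (P.opA k x : Matrix _ _ ℂ) (a, c) p * state P x y k p.1 p.2 b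
    | .bob => ∑ p : P.MemB × Chan P.qubits,
        (P.opB k y : Matrix _ _ ℂ) (b, c) p * state P x y k a p.2 p.1

/-- The output: the reduced density matrix of the output register of the party that outputs. -/
def output (P : Protocol X Y n) (x : X) (y : Y) : Matrix (Fin n) (Fin n) ℂ := fun i j =>
  let s := P.state x y (P.messages + 1)
  match P.outputParty with
  | .alice => ∑ w : P.WA, ∑ c : Chan P.qubits, ∑ b : P.MemB, s (i, w) c b * star (s (j, w) c b)
  | .bob => ∑ w : P.WB, ∑ c : Chan P.qubits, ∑ a : P.MemA, s a c (i, w) * star (s a c (j, w))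

end Protocol

/-- The three communication models. -/
inductive Model : Type
  | bobToAlice
  | aliceToBob
  | twoWay

/-- Which protocols a model admits. In a one-way model every message goes in the prescribed
direction and the receiver outputs; in the two-way model there is no restriction. -/
def Model.Admits {X Y : Type} {n : ℕ} (P : Protocol X Y n) : Model → Prop
  | .bobToAlice => (∀ k < P.messages, P.actor k = .bob) ∧ P.outputParty = .alice
  | .aliceToBob => (∀ k < P.messages, P.actor k = .alice) ∧ P.outputParty = .bob
  | .twoWay => True

/-! ### The linear regression task -/

/-- Alice's inputs. -/
abbrev InputA (m n : ℕ) : Type := Matrix (Fin m) (Fin n) ℝ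

/-- Bob's inputs. -/
abbrev InputB (m : ℕ) : Type := Fin m → ℝ

/-- On every promised input `(A, b)` the output is `ε`-close to `|A⁺b⟩` in trace distance. -/
def OutputsSolution {m n : ℕ} (P : Protocol (InputA m n) (InputB m) n)
    (D : InputA m n → InputB m → Prop) (ε : ℝ) : Prop :=
  ∀ A b, D A b → traceDist (P.output A b) (pureState ((pinv A).mulVec b)) ≤ ε

/-- The quantum communication complexity of outputting `|A⁺b⟩` with error `ε` on the inputs in `D`:
the least worst-case number of qubits communicated. -/
def quantumCC {m n : ℕ} (M : Model) (D : InputA m n → InputB m → Prop) (ε : ℝ) : ℕ∞ :=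
  ⨅ (P : Protocol (InputA m n) (InputB m) n) (_ : M.Admits P) (_ : OutputsSolution P D ε),
    (P.cost : ℕ∞)

/-- All entries of `A` and `b` are given by `k`-bit strings, decoded by `dec`, and `A⁺b ≠ 0`. -/
def Instance {m n k : ℕ} (dec : (Fin k → Bool) → ℝ) (A : InputA m n) (b : InputB m) : Prop :=
  (∀ i j, A i j ∈ Set.range dec) ∧ (∀ i, b i ∈ Set.range dec) ∧ (pinv A).mulVec b ≠ 0

/-- `‖A⁺‖ ‖b‖ / ‖A⁺b‖`. -/
def opRatio {m n : ℕ} (A : InputA m n) (b : InputB m) : ℝ :=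
  opNorm (pinv A) * vecNorm b / vecNorm ((pinv A).mulVec b)

/-- `‖A⁺‖_F ‖b‖ / ‖A⁺b‖`. -/
def frobRatio {m n : ℕ} (A : InputA m n) (b : InputB m) : ℝ :=
  frobNorm (pinv A) * vecNorm b / vecNorm ((pinv A).mulVec b)

end QRegression

end

/-!
Nothing about the pseudoinverse enters except that it is a fixed matrix `G = A⁺` known to Alice.

*Exact protocols.* Sending all entries of `b` (or of `A`) as a bit string lets the receiver prepare
`|A⁺b⟩` without error; this gives the second term of each minimum. If `m = 1`, then `A⁺b` is a
multiple of the only column of `A⁺`, so Alice needs no message at all; this matters because the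
bound is then `0`.

*One-way protocols.* The success operator `G / ‖G‖` is a contraction `S`, so together with some `F`
satisfying `SᵀS + FᵀF = 1` it is a measurement, which turns `|b⟩` into `|A⁺b⟩` with probability
`‖A⁺b‖² / (‖A⁺‖² ‖b‖²) ≥ 1 / K`. Bob sends `⌈K / ε⌉` copies of `|b⟩`, and Alice outputs the result
of the first success (`exists_firstSuccess_kraus`). In the other direction Alice sends copies of the
normalised vector of entries of `A⁺`, and Bob contracts the second index with `|b⟩`; now the success
probability is `‖A⁺b‖² / (‖A⁺‖_F² ‖b‖²)`.

*Two-way protocols.* Let `U` be the unitary "Bob prepares `|b⟩`, Alice applies the measurement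
coherently". Fixed-point amplitude amplification replaces `U` by `U R₀ U⁻¹ R U`, where `R₀` and `R`
multiply the starting state and the successful states by one and the same phase. With a suitable
phase the failure probability `Y` becomes `Y (4ΓY - 3)² / (4Γ - 3)²` (`failure_amplifyStep`), that
is, `√(ΓY)` and `√Γ` are both transformed by the Chebyshev polynomial `T₃`, up to sign. Since `T₃`
maps `[-1, 1]` to itself, `ΓY ≤ 1` is preserved, while `Γ - 1` grows at least by a factor `9` in
each step and the number of rounds by a factor `3`. Starting from `Γ = 1 + 1 / K²`, a number of
rounds proportional to `K` makes `1 / Γ`, hence the failure probability, at most `ε`. The success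
probability itself need not be known, only its lower bound `1 / K²`.

In all cases the output is a sum of rank-one terms, those of the successful branches being
proportional to `|A⁺b⟩⟨A⁺b|`; `traceDist_pureState_le` bounds its trace distance to `|A⁺b⟩` by the
weight of the other branches.
-/

noncomputable section

namespace QRegression

/-! ### Unitary completions and the trace distance -/

theorem ofReal_sum_norm_sq {I : Type*} [Fintype I] (w : I → ℂ) :
    ((∑ i, ‖w i‖ ^ 2 : ℝ) : ℂ) = star w ⬝ᵥ w := by
  rw [dotProduct, Complex.ofReal_sum]
  refine Finset.sum_congr rfl fun i _ => ?_
  rw [Pi.star_apply, Complex.star_def, Complex.conj_mul', Complex.ofReal_pow]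

theorem sum_norm_sq_encode {M J : Type*} [Fintype M] [Fintype J] [DecidableEq J] (code : M ↪ J)
    (φ : M → ℂ) :
    ∑ c, ‖∑ μ, if code μ = c then φ μ else 0‖ ^ 2 = ∑ μ, ‖φ μ‖ ^ 2 := by
  classical
  have h : ∀ c, ‖∑ μ, if code μ = c then φ μ else 0‖ ^ 2 =
      ∑ μ, if code μ = c then ‖φ μ‖ ^ 2 else 0 := by
    intro c
    by_cases hc : ∃ μ, code μ = c
    · obtain ⟨μ, rfl⟩ := hc
      simp [code.injective.eq_iff]
    · push Not at hc
      simp [hc]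
  simp_rw [h]
  rw [Finset.sum_comm]
  simp

/-- Orthonormal columns at prescribed positions extend to a unitary matrix. -/
theorem exists_unitary_columns {I M : Type*} [Fintype I] [DecidableEq I] [DecidableEq M]
    (e : M ↪ I) (V : M → I → ℂ)
    (hV : ∀ μ ν, ∑ i, star (V μ i) * V ν i = if μ = ν then 1 else 0) :
    ∃ U : Matrix.unitaryGroup I ℂ, ∀ μ i, (U : Matrix I I ℂ) i (e μ) = V μ i := by
  classical
  set v : I → EuclideanSpace ℂ I := Function.extend e (fun μ => WithLp.toLp 2 (V μ)) 0 with hv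
  have hve : ∀ μ, v (e μ) = WithLp.toLp 2 (V μ) := fun μ => e.injective.extend_apply _ _ _
  have hort : Orthonormal ℂ ((Set.range e).domRestrict v) := by
    rw [orthonormal_iff_ite]
    rintro ⟨_, μ, rfl⟩ ⟨_, ν, rfl⟩
    have h1 : ((⟨e μ, μ, rfl⟩ : Set.range e) = ⟨e ν, ν, rfl⟩) ↔ μ = ν := by
      rw [Subtype.ext_iff]
      exact e.injective.eq_iff
    have h2 : inner ℂ (v (e μ)) (v (e ν)) = if μ = ν then 1 else 0 := by
      rw [hve, hve, ← hV μ ν, PiLp.inner_apply]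
      refine Finset.sum_congr rfl fun i _ => ?_
      simp [mul_comm]
    refine Eq.trans h2 ?_
    split_ifs with h3 h4 h4 <;> first | rfl | exact absurd (h1.2 h3) h4 | exact absurd (h1.1 h4) h3
  obtain ⟨b, hb⟩ := hort.exists_orthonormalBasis_extension_of_card_eq (by simp)
  refine ⟨⟨Matrix.of fun i j => b j i, ?_⟩, fun μ i => ?_⟩
  · rw [Matrix.mem_unitaryGroup_iff']
    ext i j
    rw [Matrix.mul_apply, Matrix.one_apply]
    have := orthonormal_iff_ite.mp b.orthonormal i j
    rw [← this, PiLp.inner_apply]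
    refine Finset.sum_congr rfl fun k _ => ?_
    simp [Matrix.star_apply, mul_comm]
  · have := hb (e μ) ⟨μ, rfl⟩
    simp [this, hve]

theorem exists_unitary_column {I : Type*} [Fintype I] [DecidableEq I] (i₀ : I) (φ : I → ℂ)
    (hφ : ∑ i, ‖φ i‖ ^ 2 = 1) :
    ∃ U : Matrix.unitaryGroup I ℂ, ∀ i, (U : Matrix I I ℂ) i i₀ = φ i := by
  obtain ⟨U, hU⟩ := exists_unitary_columns (M := Unit) ⟨fun _ => i₀, fun _ _ _ => rfl⟩
    (fun _ => φ) (by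
      intro _ _
      simp only [if_true]
      rw [← Complex.ofReal_one, ← hφ, Complex.ofReal_sum]
      refine Finset.sum_congr rfl fun i _ => ?_
      rw [Complex.star_def, Complex.conj_mul', Complex.ofReal_pow])
  exact ⟨U, fun i => hU () i⟩

theorem sum_norm_sq_mulVec_of_isometry {J I : Type*} [Fintype J] [Fintype I] [DecidableEq I]
    {A : Matrix J I ℂ} (hA : A.conjTranspose * A = 1) (φ : I → ℂ) :
    ∑ j, ‖(A.mulVec φ) j‖ ^ 2 = ∑ i, ‖φ i‖ ^ 2 := by
  apply Complex.ofReal_injective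
  rw [ofReal_sum_norm_sq, ofReal_sum_norm_sq, Matrix.star_mulVec, ← Matrix.dotProduct_mulVec,
    Matrix.mulVec_mulVec, hA, Matrix.one_mulVec]

/-- The triangle inequality for the trace norm on combinations of rank-one matrices. The singular values
of `M` are the numbers `⟨F i, M e i⟩`, where `e` is an eigenbasis of `MᴴM` and `F i` is `M e i`
normalised, or zero. -/
theorem traceNorm_sum_le {n : ℕ} {Ω : Type*} [Fintype Ω] (c : Ω → ℝ) (v : Ω → Fin n → ℂ)
    (M : Matrix (Fin n) (Fin n) ℂ)
    (hM : ∀ i j, M i j = ∑ ω, (c ω : ℂ) * (v ω i * star (v ω j))) :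
    traceNorm M ≤ ∑ ω, |c ω| * ∑ i, ‖v ω i‖ ^ 2 := by
  classical
  set hH := Matrix.isHermitian_conjTranspose_mul_self M
  set e := hH.eigenvectorBasis with he
  set V : Ω → EuclideanSpace ℂ (Fin n) := fun ω => WithLp.toLp 2 (v ω) with hV
  set f : Fin n → EuclideanSpace ℂ (Fin n) := fun i => Matrix.toEuclideanLin M (e i) with hf
  have hVn : ∀ ω, ‖V ω‖ ^ 2 = ∑ i, ‖v ω i‖ ^ 2 := fun ω => EuclideanSpace.norm_sq_eq _
  have hff : ∀ i k, inner ℂ (f i) (f k) = if i = k then (hH.eigenvalues i : ℂ) else 0 := by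
    intro i k
    have h1 : inner ℂ (f i) (f k) = inner ℂ (e i) (Matrix.toEuclideanLin (M.conjTranspose * M) (e k)) := by
      have h0 : Matrix.toEuclideanLin (M.conjTranspose * M) (e k)
          = Matrix.toEuclideanLin M.conjTranspose (f k) := by
        apply WithLp.ofLp_injective 2
        simp [hf, Matrix.mulVec_mulVec]
      rw [h0, Matrix.toEuclideanLin_conjTranspose_eq_adjoint, LinearMap.adjoint_inner_right]
    have h2 : Matrix.toEuclideanLin (M.conjTranspose * M) (e k) = (hH.eigenvalues k : ℂ) • e k := by
      have := hH.mulVec_eigenvectorBasis k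
      apply (WithLp.ofLp_injective 2)
      simpa using this
    rw [h1, h2, inner_smul_right, orthonormal_iff_ite.mp e.orthonormal]
    split_ifs with h <;> simp [h]
  have hnf : ∀ i, Real.sqrt (hH.eigenvalues i) = ‖f i‖ := by
    intro i
    have := hff i i
    rw [inner_self_eq_norm_sq_to_K, if_pos rfl] at this
    have h3 : ‖f i‖ ^ 2 = hH.eigenvalues i := Complex.ofReal_injective (by push_cast; exact this)
    rw [← h3, Real.sqrt_sq (norm_nonneg _)]
  set F : Fin n → EuclideanSpace ℂ (Fin n) := fun i => ((‖f i‖⁻¹ : ℝ) : ℂ) • f i with hF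
  have hbes : ∀ w : EuclideanSpace ℂ (Fin n), ∑ i, ‖inner ℂ (F i) w‖ ^ 2 ≤ ‖w‖ ^ 2 := by
    intro w
    -- Bessel's inequality, applied to the nonzero `F i` only.
    have horth : Orthonormal ℂ (fun i : {i // f i ≠ 0} => F i) := by
      constructor
      · rintro ⟨i, hi⟩
        simp only [hF, norm_smul, Complex.norm_real, norm_inv, norm_norm]
        exact inv_mul_cancel₀ (norm_ne_zero_iff.mpr hi)
      · rintro ⟨i, hi⟩ ⟨k, hk⟩ hik
        have : i ≠ k := fun h => hik (Subtype.ext h)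
        simp [hF, inner_smul_left, inner_smul_right, hff, this]
    have := horth.sum_inner_products_le (x := w) (s := Finset.univ)
    refine le_trans (le_of_eq ?_) this
    have h0 : ∀ i, ¬ f i ≠ 0 → ‖inner ℂ (F i) w‖ ^ 2 = 0 := by
      intro i hi
      rw [not_not] at hi
      simp [hF, hi]
    rw [← Finset.sum_filter_of_ne (p := fun i => f i ≠ 0) fun i _ h => not_imp_comm.mp (h0 i) h]
    exact (Finset.sum_subtype (p := fun i => f i ≠ 0) _ (by simp) _)
  have hfi : ∀ i, f i = ∑ ω, ((c ω : ℂ) * inner ℂ (V ω) (e i)) • V ω := by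
    intro i
    ext j
    simp only [hf, Matrix.ofLp_toLpLin, Matrix.toLin'_apply, Matrix.mulVec, dotProduct, hM,
      WithLp.ofLp_sum, Finset.sum_apply, PiLp.smul_apply, smul_eq_mul, hV, PiLp.inner_apply,
      Finset.sum_mul, Finset.mul_sum]
    rw [Finset.sum_comm]
    refine Finset.sum_congr rfl fun ω _ => Finset.sum_congr rfl fun k _ => ?_
    simp
    ring
  have hfb : ∀ i, ‖f i‖ ≤ ∑ ω, |c ω| * ((‖inner ℂ (V ω) (e i)‖ ^ 2 + ‖inner ℂ (F i) (V ω)‖ ^ 2) / 2) := by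
    intro i
    have h1 : (‖f i‖ : ℂ) = inner ℂ (F i) (f i) := by
      rw [hF]
      simp only [inner_smul_left, inner_self_eq_norm_sq_to_K]
      by_cases h : ‖f i‖ = 0
      · simp [h]
      · have : (‖f i‖ : ℂ) ≠ 0 := by exact_mod_cast h
        simp
        field_simp
    have h2 : ‖f i‖ = ‖inner ℂ (F i) (f i)‖ := by
      rw [← h1]; simp
    rw [h2, show inner ℂ (F i) (f i) = inner ℂ (F i) (∑ ω, ((c ω : ℂ) * inner ℂ (V ω) (e i)) • V ω)
      from congrArg _ (hfi i), inner_sum]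
    refine (norm_sum_le _ _).trans (Finset.sum_le_sum fun ω _ => ?_)
    rw [inner_smul_right, norm_mul, norm_mul, Complex.norm_real, Real.norm_eq_abs, mul_assoc]
    refine mul_le_mul_of_nonneg_left ?_ (abs_nonneg _)
    -- `ab ≤ (a² + b²) / 2` lets the sums over `i` be evaluated separately.
    nlinarith [sq_nonneg (‖inner ℂ (V ω) (e i)‖ - ‖inner ℂ (F i) (V ω)‖)]
  calc traceNorm M = ∑ i, ‖f i‖ := Finset.sum_congr rfl fun i _ => hnf i
    _ ≤ ∑ i, ∑ ω, |c ω| * ((‖inner ℂ (V ω) (e i)‖ ^ 2 + ‖inner ℂ (F i) (V ω)‖ ^ 2) / 2) :=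
        Finset.sum_le_sum fun i _ => hfb i
    _ = ∑ ω, |c ω| * ((∑ i, ‖inner ℂ (V ω) (e i)‖ ^ 2 + ∑ i, ‖inner ℂ (F i) (V ω)‖ ^ 2) / 2) := by
        rw [Finset.sum_comm]
        refine Finset.sum_congr rfl fun ω _ => ?_
        rw [← Finset.mul_sum, ← Finset.sum_div, Finset.sum_add_distrib]
    _ ≤ ∑ ω, |c ω| * ∑ i, ‖v ω i‖ ^ 2 := by
        refine Finset.sum_le_sum fun ω _ => mul_le_mul_of_nonneg_left ?_ (abs_nonneg _)
        rw [← hVn, e.sum_sq_norm_inner_left]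
        linarith [hbes (V ω)]

open scoped MatrixOrder Matrix.Norms.L2Operator in
/-- A contraction is one half of a two-outcome measurement. -/
theorem exists_completion {n : ℕ} {M : Type*} [Fintype M] [DecidableEq M]
    (S : Matrix (Fin n) M ℝ) (hS : ∀ x : M → ℝ, ∑ i, (S.mulVec x i) ^ 2 ≤ ∑ μ, x μ ^ 2) :
    ∃ F : Matrix M M ℝ, S.transpose * S + F.transpose * F = 1 := by
  have hp : (1 - S.transpose * S).PosSemidef := by
    refine Matrix.PosSemidef.of_dotProduct_mulVec_nonneg ?_ fun x => ?_
    · simp [Matrix.IsHermitian, Matrix.conjTranspose_eq_transpose_of_trivial]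
    · have := hS x
      rw [Matrix.sub_mulVec, Matrix.one_mulVec, dotProduct_sub, ← Matrix.mulVec_mulVec,
        Matrix.dotProduct_mulVec, Matrix.vecMul_transpose]
      simp only [dotProduct, star_trivial]
      simp only [← pow_two]
      linarith
  obtain ⟨F, hF⟩ := CStarAlgebra.nonneg_iff_eq_star_mul_self.mp hp.nonneg
  refine ⟨F, ?_⟩
  rw [Matrix.star_eq_conjTranspose, Matrix.conjTranspose_eq_transpose_of_trivial] at hF
  rw [← hF]; abel

theorem vecNorm_sq {n : ℕ} (g : Fin n → ℝ) : vecNorm g ^ 2 = ∑ i, g i ^ 2 := by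
  rw [vecNorm, EuclideanSpace.norm_sq_eq]
  simp

theorem vecNorm_pos {n : ℕ} {g : Fin n → ℝ} (hg : g ≠ 0) : 0 < vecNorm g := by
  rw [vecNorm, norm_pos_iff]
  exact fun h => hg (congrArg WithLp.ofLp h)

theorem sum_div_vecNorm_sq {n : ℕ} {g : Fin n → ℝ} (hg : g ≠ 0) :
    ∑ i, (g i / vecNorm g) ^ 2 = 1 := by
  simp_rw [div_pow, ← Finset.sum_div]
  rw [← vecNorm_sq, div_self (pow_pos (vecNorm_pos hg) 2).ne']

/-- If a density matrix is a sum of rank-one terms, and the terms in `s` are proportional to `|g⟩⟨g|`,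
then its trace distance to `|g⟩` is at most the weight of the other terms. -/
theorem traceDist_pureState_le {n : ℕ} {Ω : Type*} [Fintype Ω] (ρ : Matrix (Fin n) (Fin n) ℂ)
    (v : Ω → Fin n → ℂ) (hρ : ∀ i j, ρ i j = ∑ ω, v ω i * star (v ω j))
    (hv : ∑ ω, ∑ i, ‖v ω i‖ ^ 2 = 1) {g : Fin n → ℝ} (hg : g ≠ 0) (s : Finset Ω)
    (hs : ∀ ω ∈ s, ∃ a : ℂ, ∀ i, v ω i = a * g i) {ε : ℝ}
    (hε : 1 - ε ≤ ∑ ω ∈ s, ∑ i, ‖v ω i‖ ^ 2) :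
    traceDist ρ (pureState g) ≤ ε := by
  classical
  set h : Fin n → ℂ := fun i => ((g i / vecNorm g : ℝ) : ℂ) with hh
  have hh1 : ∑ i, ‖h i‖ ^ 2 = 1 := by
    simp only [hh, Complex.norm_real, Real.norm_eq_abs, sq_abs]
    exact sum_div_vecNorm_sq hg
  have hs' : ∀ ω ∈ s, ∀ i j, v ω i * star (v ω j) =
      ((∑ k, ‖v ω k‖ ^ 2 : ℝ) : ℂ) * (h i * star (h j)) := by
    intro ω hω i j
    obtain ⟨a, ha⟩ := hs ω hω
    have hn : (vecNorm g : ℂ) ≠ 0 := by exact_mod_cast (vecNorm_pos hg).ne'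
    have h1 : ∑ k, ‖v ω k‖ ^ 2 = ‖a‖ ^ 2 * vecNorm g ^ 2 := by
      rw [vecNorm_sq, Finset.mul_sum]
      refine Finset.sum_congr rfl fun k _ => ?_
      rw [ha, norm_mul, mul_pow, Complex.norm_real, Real.norm_eq_abs, sq_abs]
    rw [h1, ha, ha, hh]
    push_cast
    rw [← Complex.conj_mul' a]
    simp only [Complex.star_def, map_mul, map_div₀, Complex.conj_ofReal]
    field_simp
  set P : ℝ := ∑ ω ∈ s, ∑ i, ‖v ω i‖ ^ 2 with hP
  have hc : P + ∑ ω ∈ sᶜ, ∑ i, ‖v ω i‖ ^ 2 = 1 := by rw [← hv, Finset.sum_add_sum_compl]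
  -- The difference is the part outside `s` plus `(P - 1) |g⟩⟨g|`, so its trace norm is at most
  -- `2 (1 - P)`.
  have hle := traceNorm_sum_le (Ω := Option (sᶜ : Finset Ω))
    (fun o => o.elim (P - 1) fun _ => 1) (fun o => o.elim h fun ω => v ω) (ρ - pureState g) (by
      intro i j
      rw [Fintype.sum_option, Matrix.sub_apply, hρ, ← Finset.sum_add_sum_compl s,
        Finset.sum_congr rfl fun ω hω => hs' ω hω i j, ← Finset.sum_mul, ← Complex.ofReal_sum, ← hP,
        ← Finset.sum_coe_sort sᶜ]
      have : pureState g i j = h i * star (h j) := by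
        simp [pureState, hh]
      rw [this]
      simp only [Option.elim]
      push_cast
      simp only [one_mul]
      ring)
  rw [Fintype.sum_option] at hle
  simp only [Option.elim, abs_one, one_mul, hh1, mul_one] at hle
  rw [Finset.sum_coe_sort sᶜ (fun ω => ∑ i, ‖v ω i‖ ^ 2)] at hle
  have hnn : 0 ≤ ∑ ω ∈ sᶜ, ∑ i, ‖v ω i‖ ^ 2 :=
    Finset.sum_nonneg fun _ _ => Finset.sum_nonneg fun _ _ => sq_nonneg _
  rw [abs_of_nonpos (by linarith)] at hle
  rw [traceDist]
  linarith

/-! ### One-way protocols from measurements -/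

/-- A protocol with a single message, in measurement form: the sender, on input `s`, sends the unit
vector `msg s` in a space with basis `M`, which `code` embeds into `T` qubits; the receiver, on input
`r`, applies a measurement with Kraus operators `kraus r ω`, which map into the output register, and
forgets the result `ω`. -/
structure OneWayScheme (S R : Type) (n T : ℕ) : Type 1 where
  M : Type
  Ω : Type
  [fintypeM : Fintype M]
  [decEqM : DecidableEq M]
  [fintypeΩ : Fintype Ω]
  [decEqΩ : DecidableEq Ω]
  [nonemptyΩ : Nonempty Ω]
  code : M ↪ Chan T
  msg : S → M → ℂ
  msg_norm : ∀ s, ∑ μ, ‖msg s μ‖ ^ 2 = 1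
  kraus : R → Ω → Matrix (Fin n) M ℂ
  kraus_complete : ∀ r, ∑ ω, (kraus r ω).conjTranspose * kraus r ω = 1

namespace OneWayScheme

attribute [instance] fintypeM decEqM fintypeΩ decEqΩ nonemptyΩ

variable {S R : Type} {n T : ℕ}

/-- The unnormalised output in the branch where the measurement gives `ω`. -/
def branch (σ : OneWayScheme S R n T) (s : S) (r : R) (ω : σ.Ω) : Fin n → ℂ :=
  (σ.kraus r ω).mulVec (σ.msg s)

theorem kraus_complete_apply (σ : OneWayScheme S R n T) (r : R) (μ ν : σ.M) :
    ∑ ω, ∑ i, star (σ.kraus r ω i μ) * σ.kraus r ω i ν = if μ = ν then 1 else 0 := by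
  have := congrFun (congrFun (σ.kraus_complete r) μ) ν
  rw [Matrix.sum_apply, Matrix.one_apply] at this
  exact this

theorem sum_norm_sq_branch (σ : OneWayScheme S R n T) (s : S) (r : R) :
    ∑ ω, ∑ i, ‖σ.branch s r ω i‖ ^ 2 = 1 := by
  rw [← σ.msg_norm s, ← Fintype.sum_prod_type',
    ← sum_norm_sq_mulVec_of_isometry (A := Matrix.of fun (p : σ.Ω × Fin n) μ => σ.kraus r p.1 p.2 μ)]
  · rfl
  · ext μ ν
    rw [Matrix.one_apply, ← σ.kraus_complete_apply r, Matrix.mul_apply, Fintype.sum_prod_type]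
    rfl

/-- The protocol `P` uses `T` qubits and outputs what the scheme `σ` outputs when the sender and the
receiver have the inputs `s x y` and `r x y`. Both depend on one of `x`, `y` only; which one is
the sender depends on the direction of communication. -/
def Realizes (σ : OneWayScheme S R n T) {X Y : Type} (P : Protocol X Y n)
    (s : X → Y → S) (r : X → Y → R) : Prop :=
  P.cost = T ∧ ∀ x y i j, P.output x y i j =
    ∑ ω, σ.branch (s x y) (r x y) ω i * star (σ.branch (s x y) (r x y) ω j)

/-- The sender's operation: it prepares the encoded message in the channel and leaves the memory in its
initial state `b₀`. -/
theorem exists_sender (σ : OneWayScheme S R n T) (b₀ : Fin n × Unit) :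
    ∃ U : S → Matrix.unitaryGroup ((Fin n × Unit) × Chan T) ℂ, ∀ s b c,
      (U s).1 (b, c) (b₀, 0) =
        if b = b₀ then ∑ μ, if σ.code μ = c then σ.msg s μ else 0 else 0 := by
  have h : ∀ s, ∃ U : Matrix.unitaryGroup ((Fin n × Unit) × Chan T) ℂ, ∀ p : (Fin n × Unit) × Chan T,
      U.1 p (b₀, 0) =
        if p.1 = b₀ then ∑ μ, if σ.code μ = p.2 then σ.msg s μ else 0 else 0 := by
    intro s
    refine exists_unitary_column _ _ ?_
    rw [Fintype.sum_prod_type, Finset.sum_eq_single b₀ (by simp +contextual) (by simp)]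
    simp only [if_true]
    rw [sum_norm_sq_encode, σ.msg_norm]
  choose U hU using h
  exact ⟨U, fun s b c => hU s (b, c)⟩

/-- The receiver's operation: a unitary dilation of the measurement which, on encoded messages, writes
the result into the workspace and resets the channel. -/
theorem exists_receiver (σ : OneWayScheme S R n T) (a₀ : Fin n × σ.Ω) :
    ∃ U : R → Matrix.unitaryGroup ((Fin n × σ.Ω) × Chan T) ℂ, ∀ r μ a c,
      (U r).1 (a, c) (a₀, σ.code μ) = if c = 0 then σ.kraus r a.2 a.1 μ else 0 := by
  have h : ∀ r, ∃ U : Matrix.unitaryGroup ((Fin n × σ.Ω) × Chan T) ℂ, ∀ μ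
      (p : (Fin n × σ.Ω) × Chan T), U.1 p (a₀, σ.code μ) =
        if p.2 = 0 then σ.kraus r p.1.2 p.1.1 μ else 0 := by
    intro r
    refine exists_unitary_columns ⟨fun μ => (a₀, σ.code μ), fun μ ν h => ?_⟩ _ fun μ ν => ?_
    · exact σ.code.injective (Prod.mk.inj h).2
    · rw [← σ.kraus_complete_apply r, Fintype.sum_prod_type, Fintype.sum_prod_type_right]
      refine Finset.sum_congr rfl fun ω _ => Finset.sum_congr rfl fun i _ => ?_
      rw [Finset.sum_eq_single 0] <;> simp +contextual
  choose U hU using h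
  exact ⟨U, fun r μ a c => hU r μ (a, c)⟩

theorem sum_receiver_sender (σ : OneWayScheme S R n T) {a₀ : Fin n × σ.Ω}
    {U : Matrix ((Fin n × σ.Ω) × Chan T) ((Fin n × σ.Ω) × Chan T) ℂ} {r : R} {s : S}
    (hU : ∀ μ a c, U (a, c) (a₀, σ.code μ) = if c = 0 then σ.kraus r a.2 a.1 μ else 0)
    (a : Fin n × σ.Ω) (c : Chan T) :
    ∑ c', U (a, c) (a₀, c') * (∑ μ, if σ.code μ = c' then σ.msg s μ else 0) =
      if c = 0 then σ.branch s r a.2 a.1 else 0 := by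
  simp_rw [Finset.mul_sum]
  rw [Finset.sum_comm]
  simp only [mul_ite, mul_zero, Finset.sum_ite_eq, Finset.mem_univ, if_true, hU]
  split_ifs
  · rfl
  · simp

theorem exists_protocol_bobToAlice (σ : OneWayScheme S R n T) (i₀ : Fin n) :
    ∃ P : Protocol R S n, Model.bobToAlice.Admits P ∧ σ.Realizes P (fun _ s => s) (fun r _ => r) := by
  obtain ⟨ω₀⟩ := σ.nonemptyΩ
  obtain ⟨V, hV⟩ := σ.exists_sender (i₀, ())
  obtain ⟨U, hU⟩ := σ.exists_receiver (i₀, ω₀)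
  let P : Protocol R S n :=
    { WA := σ.Ω, WB := Unit, qubits := T, messages := 1, first := .bob
      startA := (i₀, ω₀), startB := (i₀, ()), opA := fun _ r => U r, opB := fun _ s => V s }
  have h0 : P.actor 0 = .bob := by simp [Protocol.actor, P]
  have h1 : P.actor 1 = .alice := by simp [Protocol.actor, P, Party.other]
  refine ⟨P, ⟨fun k hk => ?_, h1⟩, Nat.one_mul T, fun r s i j => ?_⟩
  · obtain rfl : k = 0 := Nat.lt_one_iff.mp hk
    exact h0
  · have s1 : ∀ a c b, P.state r s 1 a c b = if a = (i₀, ω₀) then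
        (if b = (i₀, ()) then ∑ μ, if σ.code μ = c then σ.msg s μ else 0 else 0) else 0 := by
      intro a c b
      rw [Protocol.state, h0]
      simp only [Protocol.state, Protocol.initial]
      by_cases ha : a = (i₀, ω₀)
      · rw [if_pos ha, ← hV s, Finset.sum_eq_single ((i₀, ()), 0)]
        · rw [if_pos ⟨ha, rfl, rfl⟩, mul_one]
        · intro p _ hp
          rw [if_neg, mul_zero]
          rintro ⟨-, h2, h3⟩
          exact hp (Prod.ext h3 h2)
        · simp
      · rw [if_neg ha]
        exact Finset.sum_eq_zero fun p _ => by rw [if_neg (fun h => ha h.1), mul_zero]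
    have s2 : ∀ a c b, P.state r s 2 a c b = if b = (i₀, ()) then
        (if c = 0 then σ.branch s r a.2 a.1 else 0) else 0 := by
      intro a c b
      rw [Protocol.state, h1]
      simp only [s1]
      rw [Fintype.sum_prod_type, Finset.sum_eq_single (i₀, ω₀)]
      · by_cases hb : b = (i₀, ())
        · simp only [if_pos hb, if_true]
          exact σ.sum_receiver_sender (hU r) a c
        · simp [hb]
      · intro a' _ ha'
        simp [ha']
      · simp
    have hout : P.outputParty = .alice := h1
    rw [Protocol.output]
    simp only [hout]
    refine Finset.sum_congr rfl fun ω _ => ?_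
    rw [Finset.sum_eq_single 0, Finset.sum_eq_single (i₀, ())]
    · rw [show P.messages + 1 = 2 from rfl, s2, s2]
      simp
    · intro b _ hb
      rw [show P.messages + 1 = 2 from rfl, s2, if_neg hb, zero_mul]
    · simp
    · intro c _ hc
      refine Finset.sum_eq_zero fun b _ => ?_
      rw [show P.messages + 1 = 2 from rfl, s2, if_neg hc]
      simp
    · simp

theorem exists_protocol_aliceToBob (σ : OneWayScheme S R n T) (i₀ : Fin n) :
    ∃ P : Protocol S R n, Model.aliceToBob.Admits P ∧ σ.Realizes P (fun s _ => s) (fun _ r => r) := by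
  obtain ⟨ω₀⟩ := σ.nonemptyΩ
  obtain ⟨V, hV⟩ := σ.exists_sender (i₀, ())
  obtain ⟨U, hU⟩ := σ.exists_receiver (i₀, ω₀)
  let P : Protocol S R n :=
    { WA := Unit, WB := σ.Ω, qubits := T, messages := 1, first := .alice
      startA := (i₀, ()), startB := (i₀, ω₀), opA := fun _ s => V s, opB := fun _ r => U r }
  have h0 : P.actor 0 = .alice := by simp [Protocol.actor, P]
  have h1 : P.actor 1 = .bob := by simp [Protocol.actor, P, Party.other]
  refine ⟨P, ⟨fun k hk => ?_, h1⟩, Nat.one_mul T, fun s r i j => ?_⟩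
  · obtain rfl : k = 0 := Nat.lt_one_iff.mp hk
    exact h0
  · have s1 : ∀ a c b, P.state s r 1 a c b = if b = (i₀, ω₀) then
        (if a = (i₀, ()) then ∑ μ, if σ.code μ = c then σ.msg s μ else 0 else 0) else 0 := by
      intro a c b
      rw [Protocol.state, h0]
      simp only [Protocol.state, Protocol.initial]
      by_cases hb : b = (i₀, ω₀)
      · rw [if_pos hb, ← hV s, Finset.sum_eq_single ((i₀, ()), 0)]
        · rw [if_pos ⟨rfl, rfl, hb⟩, mul_one]
        · intro p _ hp
          rw [if_neg, mul_zero]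
          rintro ⟨h2, h3, -⟩
          exact hp (Prod.ext h2 h3)
        · simp
      · rw [if_neg hb]
        exact Finset.sum_eq_zero fun p _ => by rw [if_neg (fun h => hb h.2.2), mul_zero]
    have s2 : ∀ a c b, P.state s r 2 a c b = if a = (i₀, ()) then
        (if c = 0 then σ.branch s r b.2 b.1 else 0) else 0 := by
      intro a c b
      rw [Protocol.state, h1]
      simp only [s1]
      rw [Fintype.sum_prod_type, Finset.sum_eq_single (i₀, ω₀)]
      · by_cases ha : a = (i₀, ())
        · simp only [if_pos ha, if_true]
          exact σ.sum_receiver_sender (hU r) b c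
        · simp [ha]
      · intro b' _ hb'
        simp [hb']
      · simp
    have hout : P.outputParty = .bob := h1
    rw [Protocol.output]
    simp only [hout]
    refine Finset.sum_congr rfl fun ω _ => ?_
    rw [Finset.sum_eq_single 0, Finset.sum_eq_single (i₀, ())]
    · rw [show P.messages + 1 = 2 from rfl, s2, s2]
      simp
    · intro b _ hb
      rw [show P.messages + 1 = 2 from rfl, s2, if_neg hb, zero_mul]
    · simp
    · intro c _ hc
      refine Finset.sum_eq_zero fun b _ => ?_
      rw [show P.messages + 1 = 2 from rfl, s2, if_neg hc]
      simp
    · simp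

end OneWayScheme

/-! ### Waiting for the first success, and sending the input exactly -/

theorem sum_norm_sq_mulVec_add {n : ℕ} {M : Type*} [Fintype M] [DecidableEq M]
    {A : Matrix (Fin n) M ℂ} {F : Matrix M M ℂ}
    (h : A.conjTranspose * A + F.conjTranspose * F = 1) (φ : M → ℂ) :
    ∑ i, ‖(A.mulVec φ) i‖ ^ 2 + ∑ m, ‖(F.mulVec φ) m‖ ^ 2 = ∑ μ, ‖φ μ‖ ^ 2 := by
  have hA : (Matrix.fromRows A F).conjTranspose * Matrix.fromRows A F = 1 := by
    rw [Matrix.conjTranspose_fromRows_eq_fromCols_conjTranspose, Matrix.fromCols_mul_fromRows, h]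
  rw [← sum_norm_sq_mulVec_of_isometry hA φ, Fintype.sum_sum_type]
  simp [Matrix.fromRows_mulVec]

/-- A measurement on `N` copies which applies the two-outcome measurement `A`, `F` to one copy after the
other and stops at the first success. The branches outside `bad` output a multiple of `A φ`, and
`bad` is the event that all copies fail. The set of results and `bad` do not depend on `A` and `F`,
as the workspace of a protocol may not depend on the inputs. -/
theorem exists_firstSuccess_kraus (n N : ℕ) (M : Type) [Fintype M] [DecidableEq M] [Nonempty M] (i₀ : Fin n) :
    ∃ (Ω : Type) (_ : Fintype Ω) (_ : DecidableEq Ω) (_ : Nonempty Ω) (bad : Finset Ω),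
      ∀ (A : Matrix (Fin n) M ℂ) (F : Matrix M M ℂ),
        A.conjTranspose * A + F.conjTranspose * F = 1 →
        ∃ K : Ω → Matrix (Fin n) (Fin N → M) ℂ,
          (∑ ω, (K ω).conjTranspose * K ω = 1) ∧
          ∀ φ : M → ℂ, ∑ μ, ‖φ μ‖ ^ 2 = 1 →
            (∀ ω ∉ bad, ∃ a : ℂ, ∀ i,
              (K ω).mulVec (fun f => ∏ t, φ (f t)) i = a * (A.mulVec φ) i) ∧
            ∑ ω ∈ bad, ∑ i, ‖(K ω).mulVec (fun f => ∏ t, φ (f t)) i‖ ^ 2 =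
              (1 - ∑ i, ‖(A.mulVec φ) i‖ ^ 2) ^ N := by
  classical
  induction N with
  | zero =>
    refine ⟨Unit, inferInstance, inferInstance, inferInstance, Finset.univ, fun A F _ =>
      ⟨fun _ => Matrix.of fun i _ => if i = i₀ then 1 else 0, ?_, fun φ _ => ⟨by simp, ?_⟩⟩⟩
    · ext f f'
      rw [Subsingleton.elim f f']
      simp [Matrix.mul_apply]
    · simp [Matrix.mulVec, dotProduct, apply_ite]
  | succ N ih =>
    obtain ⟨Ω, _, _, ⟨ω₀⟩, bad, ih⟩ := ih
    -- Either the first copy succeeds and the others are measured in the standard basis, or it fails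
    -- with a residue in `M` and the measurement continues with the other copies.
    refine ⟨(Fin N → M) ⊕ (M × Ω), inferInstance, inferInstance, ?_,
      Finset.univ.filter fun o => ∃ p : M × Ω, o = Sum.inr p ∧ p.2 ∈ bad, fun A F h => ?_⟩
    · exact ⟨Sum.inr (Classical.arbitrary M, ω₀)⟩
    obtain ⟨K, hK, hφ⟩ := ih A F h
    obtain ⟨K₁, hK₁⟩ : ∃ K₁ : (Fin N → M) → Matrix (Fin n) (Fin (N + 1) → M) ℂ,
        ∀ r i f, K₁ r i f = if Fin.tail f = r then A i (f 0) else 0 := ⟨_, fun _ _ _ => rfl⟩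
    obtain ⟨K₂, hK₂⟩ : ∃ K₂ : M × Ω → Matrix (Fin n) (Fin (N + 1) → M) ℂ,
        ∀ p i f, K₂ p i f = F p.1 (f 0) * K p.2 i (Fin.tail f) := ⟨_, fun _ _ _ => rfl⟩
    refine ⟨Sum.elim K₁ K₂, ?_, fun φ h1 => ⟨?_, ?_⟩⟩
    · ext f f'
      have hk : ∑ ω, ∑ i, star (K ω i (Fin.tail f)) * K ω i (Fin.tail f') =
          if Fin.tail f = Fin.tail f' then 1 else 0 := by
        have := congrFun (congrFun hK (Fin.tail f)) (Fin.tail f')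
        rw [Matrix.sum_apply, Matrix.one_apply] at this
        exact this
      have hAF : ∑ i, star (A i (f 0)) * A i (f' 0) + ∑ m, star (F m (f 0)) * F m (f' 0) =
          if f 0 = f' 0 then 1 else 0 := by
        have := congrFun (congrFun h (f 0)) (f' 0)
        rw [Matrix.one_apply] at this
        exact this
      have hff : f = f' ↔ f 0 = f' 0 ∧ Fin.tail f = Fin.tail f' := by
        constructor
        · rintro rfl; exact ⟨rfl, rfl⟩
        · rintro ⟨h1, h2⟩
          rw [← Fin.cons_self_tail f, ← Fin.cons_self_tail f', h1, h2]
      rw [Matrix.sum_apply, Matrix.one_apply, Fintype.sum_sum_type]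
      simp only [Matrix.mul_apply, Matrix.conjTranspose_apply, Sum.elim_inl, Sum.elim_inr, hK₁, hK₂]
      have e1 : ∑ r : Fin N → M, ∑ i, star (if Fin.tail f = r then A i (f 0) else 0) *
          (if Fin.tail f' = r then A i (f' 0) else 0) =
          (∑ i, star (A i (f 0)) * A i (f' 0)) * if Fin.tail f = Fin.tail f' then 1 else 0 := by
        rw [Finset.sum_eq_single (Fin.tail f)]
        · by_cases ht : Fin.tail f = Fin.tail f'
          · simp [ht]
          · simp [ht, Ne.symm ht]
        · intro r _ hr
          simp [Ne.symm hr]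
        · simp
      have e2 : ∑ p : M × Ω, ∑ i, star (F p.1 (f 0) * K p.2 i (Fin.tail f)) *
          (F p.1 (f' 0) * K p.2 i (Fin.tail f')) =
          (∑ m, star (F m (f 0)) * F m (f' 0)) * if Fin.tail f = Fin.tail f' then 1 else 0 := by
        rw [← hk, Fintype.sum_prod_type, Finset.sum_mul_sum]
        refine Finset.sum_congr rfl fun m _ => Finset.sum_congr rfl fun ω _ => ?_
        rw [Finset.mul_sum]
        refine Finset.sum_congr rfl fun i _ => ?_
        rw [star_mul']
        ring
      rw [e1, e2, ← add_mul, hAF]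
      by_cases h3 : f 0 = f' 0 <;> by_cases h4 : Fin.tail f = Fin.tail f' <;> simp [hff, h3, h4]
    all_goals
      have hsum : ∀ G : (Fin (N + 1) → M) → ℂ, ∑ f, G f = ∑ m, ∑ f', G (Fin.cons m f') := by
        intro G
        rw [← Fintype.sum_prod_type']
        exact (Fintype.sum_equiv (Fin.consEquiv fun _ : Fin (N + 1) => M) _ _ fun _ => rfl).symm
      have hl : ∀ r i, (K₁ r).mulVec
          (fun f : Fin (N + 1) → M => ∏ t, φ (f t)) i = (∏ t, φ (r t)) * (A.mulVec φ) i := by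
        intro r i
        simp only [Matrix.mulVec, dotProduct, hsum, hK₁, Fin.tail_cons, Fin.cons_zero, ite_mul, zero_mul,
          Finset.sum_ite_eq', Finset.mem_univ, if_true, Fin.prod_univ_succ, Fin.cons_succ,
          Finset.mul_sum]
        exact Finset.sum_congr rfl fun m _ => by ring
      have hr : ∀ (p : M × Ω) i, (K₂ p).mulVec
          (fun f : Fin (N + 1) → M => ∏ t, φ (f t)) i =
          (F.mulVec φ) p.1 * (K p.2).mulVec (fun f => ∏ t, φ (f t)) i := by
        intro p i
        simp only [Matrix.mulVec, dotProduct, hsum, hK₂, Fin.tail_cons, Fin.cons_zero,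
          Fin.prod_univ_succ, Fin.cons_succ]
        rw [Finset.sum_mul_sum]
        exact Finset.sum_congr rfl fun m _ => Finset.sum_congr rfl fun f _ => by ring
    · rintro (r | p) hp
      · exact ⟨_, hl r⟩
      · have hp2 : p.2 ∉ bad := fun hb => hp (by simpa using ⟨p.1, p.2, rfl, hb⟩)
        obtain ⟨a, ha⟩ := (hφ φ h1).1 p.2 hp2
        refine ⟨(F.mulVec φ) p.1 * a, fun i => ?_⟩
        rw [Sum.elim_inr, hr, ha]
        ring
    · rw [Finset.sum_filter, Fintype.sum_sum_type]
      simp only [Sum.elim_inl, Sum.elim_inr, reduceCtorEq, false_and, exists_false, if_false,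
        Finset.sum_const_zero, zero_add, Sum.inr.injEq, exists_eq_left', hr]
      have hF : ∑ m, ‖(F.mulVec φ) m‖ ^ 2 = 1 - ∑ i, ‖(A.mulVec φ) i‖ ^ 2 := by
        rw [eq_sub_iff_add_eq', sum_norm_sq_mulVec_add h, h1]
      rw [pow_succ', ← (hφ φ h1).2, ← hF, Finset.sum_mul_sum, Fintype.sum_prod_type]
      refine Finset.sum_congr rfl fun m _ => ?_
      rw [← Finset.sum_filter, Finset.filter_mem_eq_inter, Finset.univ_inter]
      refine Finset.sum_congr rfl fun ω _ => ?_
      rw [Finset.mul_sum]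
      exact Finset.sum_congr rfl fun i _ => by rw [norm_mul, mul_pow]

namespace OneWayScheme

variable {S R : Type} {n T : ℕ}

/-- Up to weight `ε`, the branches of the scheme output a multiple of `g`. -/
def Solves (σ : OneWayScheme S R n T) (s : S) (r : R) (g : Fin n → ℝ) (ε : ℝ) : Prop :=
  ∃ bad : Finset σ.Ω, (∀ ω ∉ bad, ∃ a : ℂ, ∀ i, σ.branch s r ω i = a * g i) ∧
    ∑ ω ∈ bad, ∑ i, ‖σ.branch s r ω i‖ ^ 2 ≤ ε

theorem Realizes.traceDist_le {σ : OneWayScheme S R n T} {X Y : Type} {P : Protocol X Y n}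
    {s : X → Y → S} {r : X → Y → R} (h : σ.Realizes P s r) {x : X} {y : Y} {g : Fin n → ℝ}
    (hg : g ≠ 0) {ε : ℝ} (hσ : σ.Solves (s x y) (r x y) g ε) :
    traceDist (P.output x y) (pureState g) ≤ ε := by
  obtain ⟨bad, h1, h2⟩ := hσ
  refine traceDist_pureState_le _ _ (h.2 x y) (σ.sum_norm_sq_branch _ _) hg badᶜ
    (fun ω hω => h1 ω (Finset.mem_compl.mp hω)) ?_
  have := σ.sum_norm_sq_branch (s x y) (r x y)
  rw [← Finset.sum_add_sum_compl bad] at this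
  linarith

/-- The scheme that sends `N` copies of `φ s` and outputs the first success of the contraction `B r`. -/
theorem exists_copies {M : Type} [Fintype M] [DecidableEq M] [Nonempty M] {N : ℕ} (i₀ : Fin n)
    (code : (Fin N → M) ↪ Chan T) (φ : S → M → ℝ) (hφ : ∀ s, ∑ μ, φ s μ ^ 2 = 1)
    (B : R → Matrix (Fin n) M ℝ)
    (hB : ∀ r (x : M → ℝ), ∑ i, ((B r).mulVec x i) ^ 2 ≤ ∑ μ, x μ ^ 2) :
    ∃ σ : OneWayScheme S R n T, ∀ s r,
      σ.Solves s r ((B r).mulVec (φ s)) ((1 - ∑ i, ((B r).mulVec (φ s) i) ^ 2) ^ N) := by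
  choose F hF using fun r => exists_completion (B r) (hB r)
  obtain ⟨Ω, _, _, _, bad, hΩ⟩ := exists_firstSuccess_kraus n N M i₀
  have hc : ∀ r, ((B r).map Complex.ofReal).conjTranspose * (B r).map Complex.ofReal +
      ((F r).map Complex.ofReal).conjTranspose * (F r).map Complex.ofReal = 1 := by
    intro r
    have := congrArg (fun Z : Matrix M M ℝ => Z.map Complex.ofRealHom) (hF r)
    simp only [Matrix.map_add _ (map_add Complex.ofRealHom), Matrix.map_mul,
      Matrix.map_one _ (map_zero _) (map_one _)] at this
    rw [← this]
    congr 2 <;> (ext; simp)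
  choose K hK hK' using fun r => hΩ _ _ (hc r)
  have hnorm : ∀ s, ∑ μ, ‖((φ s μ : ℝ) : ℂ)‖ ^ 2 = 1 := by
    intro s
    simpa using hφ s
  have hmul : ∀ r s i, ((B r).map Complex.ofReal).mulVec (fun μ => ((φ s μ : ℝ) : ℂ)) i =
      (((B r).mulVec (φ s) i : ℝ) : ℂ) := by
    intro r s i
    simp [Matrix.mulVec, dotProduct]
  refine ⟨{ M := Fin N → M, Ω := Ω, code := code, msg := fun s f => ∏ t, (φ s (f t) : ℂ),
            msg_norm := fun s => ?_, kraus := K, kraus_complete := hK }, fun s r => ⟨bad, ?_, ?_⟩⟩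
  · simp only [norm_prod, ← Finset.prod_pow]
    have := Finset.prod_univ_sum (fun _ : Fin N => Finset.univ) (fun _ μ => ‖(φ s μ : ℂ)‖ ^ 2)
    rw [Fintype.piFinset_univ] at this
    rw [← this]
    simp only [hnorm, Finset.prod_const_one]
  · intro ω hω
    obtain ⟨a, ha⟩ := (hK' r _ (hnorm s)).1 ω hω
    exact ⟨a, fun i => by rw [← hmul]; exact ha i⟩
  · refine le_of_eq (((hK' r _ (hnorm s)).2).trans ?_)
    simp [hmul]

/-- The scheme that sends the classical message `w s`, from which the receiver can compute the vector to
be prepared. -/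
theorem exists_exact {M : Type} [Fintype M] [DecidableEq M] [Nonempty M] (i₀ : Fin n)
    (code : M ↪ Chan T) (w : S → M) (g : R → M → Fin n → ℝ) :
    ∃ σ : OneWayScheme S R n T, ∀ s r, g r (w s) ≠ 0 → σ.Solves s r (g r (w s)) 0 := by
  have h : ∀ r μ, ∃ u : Fin n → ℂ, ∑ i, star (u i) * u i = 1 ∧
      (g r μ ≠ 0 → ∃ a : ℂ, ∀ i, u i = a * g r μ i) := by
    intro r μ
    by_cases hg : g r μ = 0
    · exact ⟨Pi.single i₀ 1, by simp [Pi.single_apply], fun h => absurd hg h⟩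
    · refine ⟨fun i => ((g r μ i / vecNorm (g r μ) : ℝ) : ℂ), ?_, fun _ =>
        ⟨((vecNorm (g r μ) : ℝ) : ℂ)⁻¹, fun i => by push_cast; ring⟩⟩
      have := sum_div_vecNorm_sq hg
      simp only [Complex.star_def, Complex.conj_ofReal]
      rw [← Complex.ofReal_one, ← this, Complex.ofReal_sum]
      exact Finset.sum_congr rfl fun i _ => by push_cast; ring
  choose u hu hug using h
  refine ⟨{ M := M, Ω := M, code := code, msg := fun s => Pi.single (w s) 1,
            msg_norm := fun s => ?_, kraus := fun r ω => Matrix.of fun i μ => if μ = ω then u r ω i else 0,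
            kraus_complete := fun r => ?_ }, fun s r hg => ⟨Finset.univ.erase (w s), ?_, ?_⟩⟩
  · simp [Pi.single_apply, apply_ite]
  · ext μ ν
    rw [Matrix.sum_apply, Matrix.one_apply, Finset.sum_eq_single μ]
    · by_cases hμ : μ = ν
      · subst hμ
        simpa [Matrix.mul_apply] using hu r μ
      · simp [Matrix.mul_apply, hμ, Ne.symm hμ]
    · intro ω _ hω
      simp [Matrix.mul_apply, Ne.symm hω]
    · simp
  · intro ω hω
    obtain rfl : ω = w s := by simpa using hω
    obtain ⟨a, ha⟩ := hug r (w s) hg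
    refine ⟨a, fun i => ?_⟩
    rw [← ha]
    simp [branch]
  · refine le_of_eq (Finset.sum_eq_zero fun ω hω => ?_)
    have : w s ≠ ω := Ne.symm (Finset.ne_of_mem_erase hω)
    simp [branch, this]

end OneWayScheme

/-! ### Fixed-point amplitude amplification -/

/-- The diagonal unitary that multiplies the basis states satisfying `p` by `z`. -/
def phase {I : Type*} [Fintype I] [DecidableEq I] (z : Circle) (p : I → Prop) [DecidablePred p] :
    Matrix.unitaryGroup I ℂ :=
  ⟨Matrix.diagonal fun i => if p i then (z : ℂ) else 1, by
    rw [Matrix.mem_unitaryGroup_iff, Matrix.star_eq_conjTranspose, Matrix.diagonal_conjTranspose,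
      Matrix.diagonal_mul_diagonal, ← Matrix.diagonal_one]
    congr 1
    funext i
    by_cases h : p i
    · simp [h, Complex.mul_conj', Circle.norm_coe]
    · simp [h]⟩

section Amplification

variable {I : Type*} [Fintype I] [DecidableEq I]

/-- One step of amplitude amplification with equal phases at the starting state `i₀` and at the
successful basis states `p`. -/
def amplifyStep (i₀ : I) (p : I → Prop) [DecidablePred p] (z : Circle)
    (U : Matrix.unitaryGroup I ℂ) : Matrix.unitaryGroup I ℂ :=
  U * phase z (· = i₀) * U⁻¹ * phase z p * U

/-- The probability that `U`, applied to the starting state `i₀`, does not lead to a basis state in `p`. -/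
def failure (i₀ : I) (p : I → Prop) [DecidablePred p] (U : Matrix.unitaryGroup I ℂ) : ℝ :=
  ∑ i, if p i then 0 else ‖U.1 i i₀‖ ^ 2

theorem sum_norm_sq_column (U : Matrix.unitaryGroup I ℂ) (i₀ : I) :
    ∑ i, ‖U.1 i i₀‖ ^ 2 = 1 := by
  have := sum_norm_sq_mulVec_of_isometry (A := U.1) (Matrix.mem_unitaryGroup_iff'.mp U.2)
    (Pi.single i₀ 1)
  simpa [Pi.single_apply, apply_ite] using this

/-- Conjugating the phase at `i₀` by `U` gives `1 + (z - 1) |ψ⟩⟨ψ|`, where `ψ` is the column of `U` at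
`i₀`. -/
theorem reflect_mulVec (U : Matrix.unitaryGroup I ℂ) (i₀ : I) (z : Circle) (w : I → ℂ) (i : I) :
    (U * phase z (· = i₀) * U⁻¹).1.mulVec w i =
      w i + ((z : ℂ) - 1) * (∑ k, star (U.1 k i₀) * w k) * U.1 i i₀ := by
  have h1 : (phase z (· = i₀)).1 = 1 + ((z : ℂ) - 1) • Matrix.single i₀ i₀ (1 : ℂ) := by
    ext a b
    by_cases hab : a = b
    · subst hab
      by_cases ha : a = i₀
      · subst ha; simp [phase]
      · simp [phase, ha, Ne.symm ha]
    · have : ¬ (i₀ = a ∧ i₀ = b) := fun h => hab (h.1.symm.trans h.2)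
      simp [phase, hab, this]
  have h2 : U.1 * star U.1 = 1 := Matrix.mem_unitaryGroup_iff.mp U.2
  have h3 : (U * phase z (· = i₀) * U⁻¹).1 =
      1 + ((z : ℂ) - 1) • (U.1 * Matrix.single i₀ i₀ (1 : ℂ) * star U.1) := by
    change U.1 * (phase z (· = i₀)).1 * star U.1 = _
    rw [h1, Matrix.mul_add, Matrix.add_mul, Matrix.mul_one, h2, Matrix.mul_smul, Matrix.smul_mul]
  have h4 : (U.1 * Matrix.single i₀ i₀ (1 : ℂ) * star U.1) =
      Matrix.vecMulVec (fun i => U.1 i i₀) (fun k => star (U.1 k i₀)) := by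
    ext a b
    simp [Matrix.mul_apply, Matrix.vecMulVec_apply, Matrix.single_apply, Matrix.star_apply,
      ite_and, ite_mul]
  rw [h3, h4, Matrix.add_mulVec, Matrix.one_mulVec, Matrix.smul_mulVec, Matrix.vecMulVec_mulVec]
  simp [dotProduct]
  ring

theorem amplifyStep_apply (i₀ : I) (p : I → Prop) [DecidablePred p] (z : Circle)
    (U : Matrix.unitaryGroup I ℂ) (i : I) :
    (amplifyStep i₀ p z U).1 i i₀ = ((if p i then (z : ℂ) else 1) +
      ((z : ℂ) - 1) * (1 + ((z : ℂ) - 1) * (1 - failure i₀ p U))) * U.1 i i₀ := by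
  have h1 : (amplifyStep i₀ p z U).1 i i₀ = (U * phase z (· = i₀) * U⁻¹).1.mulVec
      (fun k => (if p k then (z : ℂ) else 1) * U.1 k i₀) i := by
    rw [amplifyStep, mul_assoc _ (phase z p) U]
    change ((U * phase z (· = i₀) * U⁻¹).1 * ((phase z p).1 * U.1)) i i₀ = _
    rw [Matrix.mul_apply]
    refine Finset.sum_congr rfl fun k _ => ?_
    exact congrArg (_ * ·) (Matrix.diagonal_mul _ _ _ _)
  have h2 : ∑ k, star (U.1 k i₀) * ((if p k then (z : ℂ) else 1) * U.1 k i₀) =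
      1 + ((z : ℂ) - 1) * (1 - failure i₀ p U) := by
    -- Summed over `k` this reads `z - (z - 1) Y`, where `Y` is the failure probability.
    have e : ∀ k, star (U.1 k i₀) * ((if p k then (z : ℂ) else 1) * U.1 k i₀) =
        (z : ℂ) * ((‖U.1 k i₀‖ ^ 2 : ℝ) : ℂ) -
          ((z : ℂ) - 1) * ((if p k then 0 else ‖U.1 k i₀‖ ^ 2 : ℝ) : ℂ) := by
      intro k
      have : star (U.1 k i₀) * U.1 k i₀ = ((‖U.1 k i₀‖ ^ 2 : ℝ) : ℂ) := by
        rw [Complex.star_def, Complex.conj_mul', Complex.ofReal_pow]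
      rw [mul_left_comm, this]
      split_ifs
      · simp
      · push_cast
        ring
    simp_rw [e]
    rw [Finset.sum_sub_distrib, ← Finset.mul_sum, ← Finset.mul_sum, ← Complex.ofReal_sum,
      ← Complex.ofReal_sum, sum_norm_sq_column, failure]
    push_cast
    ring
  rw [h1, reflect_mulVec, h2]
  ring

/-- The phase that realises the cubic `T₃(√Γ y) / T₃(√Γ)`. It is a root of `κ (z - 1)² + z = 0`, where
`κ = 1 - 3 / (4Γ) ≥ 1 / 4`; this real quadratic has no two distinct real roots, and the product of
its roots is `1`. -/
theorem exists_phase {Γ : ℝ} (hΓ : 1 ≤ Γ) :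
    ∃ z : Circle, (z : ℂ) * (4 * Γ) = -((4 * Γ - 3) * ((z : ℂ) - 1) ^ 2) := by
  set κ : ℝ := 1 - 3 / (4 * Γ) with hκ
  have hΓ0 : (4 * Γ) ≠ 0 := by positivity
  have hκΓ : κ * (4 * Γ) = 4 * Γ - 3 := by rw [hκ]; field_simp
  have hκ1 : 1 ≤ 4 * κ := by
    have : 3 / (4 * Γ) ≤ 3 / 4 := by
      rw [div_le_div_iff₀ (by positivity) (by norm_num)]; linarith
    linarith
  have hκ0 : 0 < κ := by linarith
  set r : ℝ := Real.sqrt (4 * κ - 1) with hr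
  have hr2 : r ^ 2 = 4 * κ - 1 := Real.sq_sqrt (by linarith)
  -- The discriminant of the quadratic for `z` is `1 - 4κ ≤ 0`.
  set z : ℂ := ⟨(2 * κ - 1) / (2 * κ), r / (2 * κ)⟩ with hz
  have hz1 : ‖z‖ = 1 := by
    rw [← sq_eq_sq₀ (norm_nonneg _) zero_le_one, Complex.sq_norm, Complex.normSq_apply, hz]
    simp only
    field_simp
    linarith
  have hz2 : z = -(κ * (z - 1) ^ 2) := by
    apply Complex.ext
    · simp [hz, pow_two]
      field_simp
      nlinarith
    · simp [hz, pow_two]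
      field_simp
      ring
  refine ⟨⟨z, by simpa [Submonoid.unitSphere] using hz1⟩, ?_⟩
  have h3 : ((κ : ℂ)) * (4 * Γ) = 4 * Γ - 3 := by exact_mod_cast congrArg Complex.ofReal hκΓ
  change z * (4 * Γ) = -((4 * Γ - 3) * (z - 1) ^ 2)
  rw [← h3]
  nth_rewrite 1 [hz2]
  ring

/-- Up to a phase, one step multiplies the failure amplitude by `(4ΓY - 3) / (4Γ - 3)`, where `Y` is the
failure probability. -/
theorem failure_amplifyStep (i₀ : I) (p : I → Prop) [DecidablePred p] {z : Circle} {Γ : ℝ}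
    (hΓ : 1 ≤ Γ) (hz : (z : ℂ) * (4 * Γ) = -((4 * Γ - 3) * ((z : ℂ) - 1) ^ 2))
    (U : Matrix.unitaryGroup I ℂ) :
    (4 * Γ - 3) ^ 2 * failure i₀ p (amplifyStep i₀ p z U) =
      (4 * Γ * failure i₀ p U - 3) ^ 2 * failure i₀ p U := by
  set Y := failure i₀ p U with hY
  set u : ℂ := (z : ℂ) - 1 with hu
  have hzn : ‖(z : ℂ)‖ = 1 := Circle.norm_coe z
  have hu2 : (4 * Γ - 3) * ‖u ^ 2‖ = 4 * Γ := by
    have := congrArg norm hz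
    rw [norm_mul, hzn, norm_neg, one_mul] at this
    have e1 : (4 * (Γ : ℂ)) = ((4 * Γ : ℝ) : ℂ) := by push_cast; ring
    have e2 : ((4 * (Γ : ℂ)) - 3) = ((4 * Γ - 3 : ℝ) : ℂ) := by push_cast; ring
    rw [e2, e1, norm_mul, Complex.norm_real, Complex.norm_real, Real.norm_of_nonneg (by linarith),
      Real.norm_of_nonneg (by linarith)] at this
    exact this.symm
  have hd : (4 * Γ - 3) * ‖(1 : ℂ) + u * (1 + u * (1 - Y))‖ = |4 * Γ * Y - 3| := by
    have h1 : (4 * (Γ : ℂ)) * (1 + u * (1 + u * (1 - Y))) = u ^ 2 * ((3 - 4 * Γ * Y : ℝ) : ℂ) := by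
      push_cast
      rw [show (1 : ℂ) + u * (1 + u * (1 - Y)) = z + u ^ 2 * (1 - Y) by rw [hu]; ring, mul_add,
        mul_comm (4 * (Γ : ℂ)), hz]
      ring
    have e1 : (4 * (Γ : ℂ)) = ((4 * Γ : ℝ) : ℂ) := by push_cast; ring
    rw [e1] at h1
    have h2 := congrArg norm h1
    rw [norm_mul, norm_mul, Complex.norm_real, Complex.norm_real,
      Real.norm_of_nonneg (by linarith), Real.norm_eq_abs, abs_sub_comm] at h2
    have h3 : (4 * Γ) * ((4 * Γ - 3) * ‖(1 : ℂ) + u * (1 + u * (1 - Y))‖) =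
        (4 * Γ) * |4 * Γ * Y - 3| := by
      rw [mul_left_comm, h2, ← mul_assoc, hu2]
    exact mul_left_cancel₀ (by linarith) h3
  have hf : failure i₀ p (amplifyStep i₀ p z U) = ‖(1 : ℂ) + u * (1 + u * (1 - Y))‖ ^ 2 * Y := by
    rw [hY, failure, failure, Finset.mul_sum]
    refine Finset.sum_congr rfl fun i _ => ?_
    rw [amplifyStep_apply]
    split_ifs
    · simp
    · rw [norm_mul, mul_pow]
      rfl
  rw [hf, ← mul_assoc, ← mul_pow, hd, sq_abs]

/-- The squares of the iterates of `T₃` at `√Γ₀`. -/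
def chebGain (Γ₀ : ℝ) : ℕ → ℝ
  | 0 => Γ₀
  | l + 1 => chebGain Γ₀ l * (4 * chebGain Γ₀ l - 3) ^ 2

theorem le_chebGain {Γ₀ : ℝ} (h : 1 ≤ Γ₀) (l : ℕ) : 1 + 9 ^ l * (Γ₀ - 1) ≤ chebGain Γ₀ l := by
  induction l with
  | zero => simp [chebGain]
  | succ l ih =>
    have h1 : 1 ≤ chebGain Γ₀ l := le_trans (by nlinarith [pow_pos (show (0 : ℝ) < 9 by norm_num) l]) ih
    set G := chebGain Γ₀ l with hG
    -- `T₃(x)² - 1 = (x² - 1) (4x² - 1)²`.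
    have h2 : chebGain Γ₀ (l + 1) = 1 + (G - 1) * (4 * G - 1) ^ 2 := by rw [chebGain, ← hG]; ring
    rw [h2, pow_succ]
    have h3 : (9 : ℝ) ≤ (4 * G - 1) ^ 2 := by nlinarith
    nlinarith [mul_le_mul_of_nonneg_left h3 (sub_nonneg.mpr h1)]

theorem one_le_chebGain {Γ₀ : ℝ} (h : 1 ≤ Γ₀) (l : ℕ) : 1 ≤ chebGain Γ₀ l :=
  le_trans (by nlinarith [pow_pos (show (0 : ℝ) < 9 by norm_num) l]) (le_chebGain h l)

/-- The iteration of `amplifyStep`, with its own phase in each step. -/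
def amplify (i₀ : I) (p : I → Prop) [DecidablePred p] (z : ℕ → Circle)
    (U : Matrix.unitaryGroup I ℂ) : ℕ → Matrix.unitaryGroup I ℂ
  | 0 => U
  | l + 1 => amplifyStep i₀ p (z l) (amplify i₀ p z U l)

/-- Amplification only rescales the successful part of the state, so it does not change the output. -/
theorem amplify_apply_of_good (i₀ : I) (p : I → Prop) [DecidablePred p] (z : ℕ → Circle)
    (U : Matrix.unitaryGroup I ℂ) (l : ℕ) :
    ∃ a : ℂ, ∀ i, p i → (amplify i₀ p z U l).1 i i₀ = a * U.1 i i₀ := by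
  induction l with
  | zero => exact ⟨1, fun i _ => by rw [one_mul, amplify]⟩
  | succ l ih =>
    obtain ⟨a, ha⟩ := ih
    exact ⟨_, fun i hi => by rw [amplify, amplifyStep_apply, if_pos hi, ha i hi, ← mul_assoc]⟩

theorem chebGain_mul_failure_le (i₀ : I) (p : I → Prop) [DecidablePred p] {Γ₀ : ℝ} (hΓ : 1 ≤ Γ₀)
    {z : ℕ → Circle} (hz : ∀ l, (z l : ℂ) * (4 * chebGain Γ₀ l) =
      -((4 * chebGain Γ₀ l - 3) * ((z l : ℂ) - 1) ^ 2))
    (U : Matrix.unitaryGroup I ℂ) (hU : Γ₀ * failure i₀ p U ≤ 1) (l : ℕ) :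
    chebGain Γ₀ l * failure i₀ p (amplify i₀ p z U l) ≤ 1 := by
  induction l with
  | zero => exact hU
  | succ l ih =>
    have h := failure_amplifyStep i₀ p (one_le_chebGain hΓ l) (hz l) (amplify i₀ p z U l)
    have hΓl := one_le_chebGain hΓ l
    have hY : 0 ≤ failure i₀ p (amplify i₀ p z U l) :=
      Finset.sum_nonneg fun i _ => by split_ifs <;> positivity
    rw [amplify, chebGain, mul_assoc, h]
    set Z := chebGain Γ₀ l * failure i₀ p (amplify i₀ p z U l) with hZ
    -- In terms of `Z = ΓY` the step is `Z ↦ Z (4Z - 3)²`, which preserves `Z ≤ 1`.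
    have : chebGain Γ₀ l * ((4 * chebGain Γ₀ l * failure i₀ p (amplify i₀ p z U l) - 3) ^ 2 *
        failure i₀ p (amplify i₀ p z U l)) = 1 - (1 - Z) * (4 * Z - 1) ^ 2 := by rw [hZ]; ring
    rw [this]
    have := mul_nonneg (sub_nonneg.mpr ih) (sq_nonneg (4 * Z - 1))
    linarith

end Amplification

/-! ### Interactive protocols -/

section Interaction

variable {X Y Mem : Type} [Fintype Mem] [DecidableEq Mem] {T : ℕ}

/-- A unitary of the channel, acting on the memory as the identity. -/
def onChan (Mem : Type) [Fintype Mem] [DecidableEq Mem] {T : ℕ}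
    (V : Matrix.unitaryGroup (Chan T) ℂ) : Matrix.unitaryGroup (Mem × Chan T) ℂ :=
  ⟨Matrix.kroneckerMap (· * ·) (1 : Matrix Mem Mem ℂ) V.1,
    Matrix.kronecker_mem_unitary (one_mem _) V.2⟩

theorem onChan_inv (V : Matrix.unitaryGroup (Chan T) ℂ) : (onChan Mem V)⁻¹ = onChan Mem V⁻¹ := by
  apply Subtype.ext
  change star (Matrix.kroneckerMap (· * ·) (1 : Matrix Mem Mem ℂ) V.1) =
    Matrix.kroneckerMap (· * ·) (1 : Matrix Mem Mem ℂ) (star V.1)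
  rw [Matrix.star_eq_conjTranspose, Matrix.conjTranspose_kronecker, Matrix.conjTranspose_one,
    Matrix.star_eq_conjTranspose]

theorem sum_onChan (V : Matrix.unitaryGroup (Chan T) ℂ) (a : Mem) (c : Chan T)
    (w : Mem × Chan T → ℂ) :
    ∑ p, (onChan Mem V).1 (a, c) p * w p = ∑ c', V.1 c c' * w (a, c') := by
  rw [Fintype.sum_prod_type, Finset.sum_eq_single a]
  · simp [onChan]
  · intro a' _ ha'
    simp [onChan, Ne.symm ha']
  · simp

/-- `Interactive q U` says that `U x y`, on Alice's memory and the channel, is obtained by `q` rounds, in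
each of which Alice applies a unitary depending on `x` and then Bob applies a unitary to the channel
only, depending on `y`; Alice acts last. -/
inductive Interactive : ℕ → (X → Y → Matrix.unitaryGroup (Mem × Chan T) ℂ) → Prop
  | alice (u : X → Matrix.unitaryGroup (Mem × Chan T) ℂ) : Interactive 0 fun x _ => u x
  | round {q : ℕ} {U : X → Y → Matrix.unitaryGroup (Mem × Chan T) ℂ}
      (u : X → Matrix.unitaryGroup (Mem × Chan T) ℂ) (v : Y → Matrix.unitaryGroup (Chan T) ℂ) :
      Interactive q U → Interactive (q + 1) fun x y => u x * onChan Mem (v y) * U x y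

namespace Interactive

variable {U V : X → Y → Matrix.unitaryGroup (Mem × Chan T) ℂ} {q r : ℕ}

theorem alice_mul (u : X → Matrix.unitaryGroup (Mem × Chan T) ℂ) (h : Interactive q U) :
    Interactive q fun x y => u x * U x y := by
  cases h with
  | alice u' => exact alice fun x => u x * u' x
  | round u' v h =>
    simp only [← mul_assoc]
    exact round (fun x => u x * u' x) v h

theorem mul (hU : Interactive q U) (hV : Interactive r V) :
    Interactive (q + r) fun x y => U x y * V x y := by
  induction hU with
  | alice u => rw [zero_add]; exact alice_mul u hV
  | round u v _ ih =>
    rw [Nat.add_right_comm]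
    simp only [mul_assoc (_ * _)]
    exact round u v ih

theorem inv (hU : Interactive q U) : Interactive q fun x y => (U x y)⁻¹ := by
  induction hU with
  | alice u => exact alice fun x => (u x)⁻¹
  | round u v _ ih =>
    simp only [mul_inv_rev, onChan_inv]
    have h1 := round (fun _ => 1) (fun y => (v y)⁻¹) (alice fun x => (u x)⁻¹)
    simp only [one_mul] at h1
    exact mul ih h1

theorem amplify (hU : Interactive q U) (i₀ : Mem × Chan T) (p : Mem × Chan T → Prop)
    [DecidablePred p] (z : ℕ → Circle) (l : ℕ) :
    Interactive (3 ^ l * q) fun x y => QRegression.amplify i₀ p z (U x y) l := by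
  induction l with
  | zero => simpa [QRegression.amplify] using hU
  | succ l ih =>
    have h1 := ih.mul ((alice fun _ => phase (z l) (· = i₀)).mul
      (ih.inv.mul ((alice fun _ => phase (z l) p).mul ih)))
    have h2 : 3 ^ l * q + (0 + (3 ^ l * q + (0 + 3 ^ l * q))) = 3 ^ (l + 1) * q := by ring
    rw [h2] at h1
    simpa only [QRegression.amplify, amplifyStep, mul_assoc] using h1

end Interactive

/-- The product of the operations in `k` rounds, `u j` being Alice's and `v j` Bob's. -/
def alternate (u : ℕ → X → Matrix.unitaryGroup (Mem × Chan T) ℂ)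
    (v : ℕ → Y → Matrix.unitaryGroup (Chan T) ℂ) (x : X) (y : Y) :
    ℕ → Matrix.unitaryGroup (Mem × Chan T) ℂ
  | 0 => u 0 x
  | k + 1 => u (k + 1) x * onChan Mem (v k y) * alternate u v x y k

theorem Interactive.exists_alternate {U : X → Y → Matrix.unitaryGroup (Mem × Chan T) ℂ} {q : ℕ}
    (h : Interactive q U) : ∃ (u : ℕ → X → Matrix.unitaryGroup (Mem × Chan T) ℂ)
      (v : ℕ → Y → Matrix.unitaryGroup (Chan T) ℂ), ∀ x y, alternate u v x y q = U x y := by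
  induction h with
  | alice u => exact ⟨fun _ => u, fun _ _ => 1, fun _ _ => rfl⟩
  | @round q U u₁ v₁ _ ih =>
    obtain ⟨u, v, huv⟩ := ih
    have key : ∀ x y, ∀ k ≤ q, alternate (fun j => if j = q + 1 then u₁ else u j)
        (fun j => if j = q then v₁ else v j) x y k = alternate u v x y k := by
      intro x y k
      induction k with
      | zero => intro _; simp [alternate]
      | succ k ihk =>
        intro hk
        have h1 : k ≠ q := by omega
        have h2 : k + 1 ≠ q + 1 := by omega
        simp only [alternate, if_neg h1, if_neg h2, ihk (by omega)]
    refine ⟨fun j => if j = q + 1 then u₁ else u j, fun j => if j = q then v₁ else v j,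
      fun x y => ?_⟩
    rw [alternate, key x y q le_rfl, huv]
    simp

end Interaction

/-- Each round costs two messages. Bob's memory stays in its initial state. -/
theorem Interactive.exists_protocol {X Y W : Type} {n T q : ℕ} [Fintype W] [DecidableEq W]
    {U : X → Y → Matrix.unitaryGroup ((Fin n × W) × Chan T) ℂ} (h : Interactive q U)
    (a₀ : Fin n × W) :
    ∃ P : Protocol X Y n, P.cost = 2 * q * T ∧ ∀ x y i j, P.output x y i j =
      ∑ ω : W × Chan T, (U x y).1 ((i, ω.1), ω.2) (a₀, 0) *
        star ((U x y).1 ((j, ω.1), ω.2) (a₀, 0)) := by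
  obtain ⟨u, v, huv⟩ := h.exists_alternate
  let P : Protocol X Y n :=
    { WA := W, WB := Unit, qubits := T, messages := 2 * q, first := .alice
      startA := a₀, startB := (a₀.1, ()), opA := fun k x => u (k / 2) x
      opB := fun k y => onChan (Fin n × Unit) (v (k / 2) y) }
  have ha : ∀ k, P.actor (2 * k) = .alice := fun k => by simp [Protocol.actor, P]
  have hb : ∀ k, P.actor (2 * k + 1) = .bob := fun k => by simp [Protocol.actor, P, Party.other]
  have hs : ∀ x y k a c b, P.state x y (2 * k + 1) a c b =
      if b = (a₀.1, ()) then (alternate u v x y k).1 (a, c) (a₀, 0) else 0 := by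
    intro x y k
    induction k with
    | zero =>
      intro a c b
      rw [Protocol.state, ha 0]
      simp only [Nat.mul_zero, Protocol.state, Protocol.initial]
      by_cases hb : b = (a₀.1, ())
      · rw [if_pos hb, Finset.sum_eq_single (a₀, 0)]
        · rw [if_pos ⟨rfl, rfl, hb⟩, mul_one]
          rfl
        · intro p _ hp
          rw [if_neg, mul_zero]
          rintro ⟨h2, h3, -⟩
          exact hp (Prod.ext h2 h3)
        · simp
      · rw [if_neg hb]
        exact Finset.sum_eq_zero fun p _ => by rw [if_neg (fun h => hb h.2.2), mul_zero]
    | succ k ih =>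
      have h2 : ∀ a c b, P.state x y (2 * k + 2) a c b = if b = (a₀.1, ()) then
          (onChan (Fin n × W) (v k y) * alternate u v x y k).1 (a, c) (a₀, 0) else 0 := by
        intro a c b
        rw [Protocol.state, hb k]
        simp only [ih]
        have e1 : (2 * k + 1) / 2 = k := by omega
        have e2 := sum_onChan (v ((2 * k + 1) / 2) y) b c fun p => if p.1 = (a₀.1, ()) then
          (alternate u v x y k).1 (a, p.2) (a₀, 0) else 0
        refine e2.trans ?_
        rw [e1]
        by_cases hb : b = (a₀.1, ())
        · simp only [if_pos hb]
          exact (sum_onChan (v k y) a c fun p => (alternate u v x y k).1 p (a₀, 0)).symm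
        · simp [hb]
      intro a c b
      rw [show 2 * (k + 1) + 1 = (2 * k + 2) + 1 by ring, Protocol.state,
        show 2 * k + 2 = 2 * (k + 1) by ring, ha (k + 1)]
      simp only [show 2 * (k + 1) = 2 * k + 2 by ring, h2]
      have e1 : (2 * k + 2) / 2 = k + 1 := by omega
      by_cases hb : b = (a₀.1, ())
      · simp only [if_pos hb]
        rw [alternate, mul_assoc]
        change ∑ p, (u ((2 * k + 2) / 2) x).1 (a, c) p * _ = _
        rw [e1]
        rfl
      · simp [hb]
  refine ⟨P, rfl, fun x y i j => ?_⟩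
  have hout : P.outputParty = .alice := ha q
  rw [Protocol.output]
  simp only [hout]
  rw [Fintype.sum_prod_type]
  refine Finset.sum_congr rfl fun w _ => Finset.sum_congr rfl fun c _ => ?_
  rw [Finset.sum_eq_single (a₀.1, ())]
  · rw [show P.messages + 1 = 2 * q + 1 from rfl, hs, hs, if_pos rfl, if_pos rfl, huv]
  · intro b _ hb
    rw [show P.messages + 1 = 2 * q + 1 from rfl, hs, if_neg hb, zero_mul]
  · simp

/-- Amplification of a contraction `B x` applied to a unit vector `φ y`. Alice's workspace `Option M`
flags success by `none` and stores the result of the complementary operator otherwise. -/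
theorem exists_protocol_amplify {X Y M : Type} {n T : ℕ} [Fintype M] [DecidableEq M] (i₀ : Fin n)
    (code : M ↪ Chan T) (φ : Y → M → ℝ) (hφ : ∀ y, ∑ μ, φ y μ ^ 2 = 1)
    (B : X → Matrix (Fin n) M ℝ)
    (hB : ∀ x (w : M → ℝ), ∑ i, ((B x).mulVec w i) ^ 2 ≤ ∑ μ, w μ ^ 2)
    {δ : ℝ} (hδ : 0 ≤ δ) (l : ℕ) :
    ∃ P : Protocol X Y n, P.cost = 2 * 3 ^ l * T ∧ ∀ x y, (B x).mulVec (φ y) ≠ 0 →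
      δ ≤ ∑ i, ((B x).mulVec (φ y) i) ^ 2 →
      traceDist (P.output x y) (pureState ((B x).mulVec (φ y))) ≤ (1 + 9 ^ l * δ)⁻¹ := by
  choose F hF using fun x => exists_completion (B x) (hB x)
  have hprep : ∀ y, ∃ V : Matrix.unitaryGroup (Chan T) ℂ, ∀ c,
      V.1 c 0 = ∑ μ, if code μ = c then (φ y μ : ℂ) else 0 := by
    intro y
    refine exists_unitary_column _ _ ?_
    rw [sum_norm_sq_encode]
    simpa using hφ y
  choose V hV using hprep
  let a₀ : Fin n × Option M := (i₀, none)
  have hblock : ∀ x, ∃ U : Matrix.unitaryGroup ((Fin n × Option M) × Chan T) ℂ, ∀ μ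
      (p : (Fin n × Option M) × Chan T), U.1 p (a₀, code μ) = if p.2 = 0 then
        ((p.1.2.elim (B x p.1.1 μ) fun ν => if p.1.1 = i₀ then F x ν μ else 0 : ℝ) : ℂ) else 0 := by
    intro x
    refine exists_unitary_columns ⟨fun μ => (a₀, code μ), fun μ ν h => ?_⟩ _ fun μ ν => ?_
    · exact code.injective (Prod.mk.inj h).2
    · have h1 := congrFun (congrFun (hF x) μ) ν
      rw [Matrix.add_apply, Matrix.mul_apply, Matrix.mul_apply, Matrix.one_apply] at h1
      have h2 : (if μ = ν then 1 else 0 : ℂ) = ((if μ = ν then 1 else 0 : ℝ) : ℂ) := by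
        split_ifs <;> simp
      rw [h2, ← h1, Fintype.sum_prod_type, Fintype.sum_prod_type_right]
      simp only [Matrix.transpose_apply]
      rw [Fintype.sum_option, Complex.ofReal_add, Complex.ofReal_sum, Complex.ofReal_sum]
      congr 1
      · refine Finset.sum_congr rfl fun i _ => ?_
        rw [Finset.sum_eq_single 0] <;> simp +contextual
      · refine Finset.sum_congr rfl fun k _ => ?_
        rw [Finset.sum_eq_single i₀, Finset.sum_eq_single 0] <;> simp +contextual
  choose U hU using hblock
  -- One round prepares the state to be amplified: Bob's part of `φ`, then Alice's measurement.
  let W : X → Y → Matrix.unitaryGroup ((Fin n × Option M) × Chan T) ℂ :=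
    fun x y => U x * onChan (Fin n × Option M) (V y)
  have hW : Interactive 1 W := by
    have := Interactive.round U V (Interactive.alice fun _ => 1)
    simpa only [mul_one] using this
  have hWcol : ∀ x y i (c : Chan T), (W x y).1 ((i, none), c) (a₀, 0) =
      if c = 0 then (((B x).mulVec (φ y) i : ℝ) : ℂ) else 0 := by
    intro x y i c
    have h1 : ∀ p : (Fin n × Option M) × Chan T, (onChan (Fin n × Option M) (V y)).1 p (a₀, 0) =
        if p.1 = a₀ then ∑ μ, if code μ = p.2 then (φ y μ : ℂ) else 0 else 0 := by
      rintro ⟨a, c⟩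
      simp only [← hV]
      by_cases ha : a = a₀ <;> simp [onChan, ha]
    change ((U x).1 * (onChan (Fin n × Option M) (V y)).1) ((i, none), c) (a₀, 0) = _
    rw [Matrix.mul_apply, Fintype.sum_prod_type, Finset.sum_eq_single a₀]
    · simp only [h1, if_true, Finset.mul_sum]
      rw [Finset.sum_comm]
      simp only [mul_ite, mul_zero, Finset.sum_ite_eq, Finset.mem_univ, if_true, hU, Option.elim]
      split_ifs
      · simp [Matrix.mulVec, dotProduct]
      · simp
    · intro a _ ha
      simp [h1, ha]
    · simp
  let p : (Fin n × Option M) × Chan T → Prop := fun p => p.1.2 = none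
  have hΓ : 1 ≤ 1 + δ := by linarith
  choose z hz using fun l => exists_phase (one_le_chebGain hΓ l)
  obtain ⟨P, hP, hout⟩ := (hW.amplify (a₀, 0) p z l).exists_protocol a₀
  have hfail : ∀ R : Matrix.unitaryGroup ((Fin n × Option M) × Chan T) ℂ,
      failure (a₀, 0) p R = 1 - ∑ c, ∑ i, ‖R.1 ((i, none), c) (a₀, 0)‖ ^ 2 := by
    intro R
    rw [← sum_norm_sq_column R (a₀, 0), failure, eq_sub_iff_add_eq, Fintype.sum_prod_type_right,
      Fintype.sum_prod_type_right, ← Finset.sum_add_distrib]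
    refine Finset.sum_congr rfl fun c _ => ?_
    rw [Fintype.sum_prod_type, Fintype.sum_prod_type, ← Finset.sum_add_distrib]
    refine Finset.sum_congr rfl fun i _ => ?_
    rw [Fintype.sum_option, Fintype.sum_option]
    simp [p, add_comm]
  refine ⟨P, by rw [hP, mul_one], fun x y hg hxy => ?_⟩
  have hf0 : failure (a₀, 0) p (W x y) = 1 - ∑ i, ((B x).mulVec (φ y) i) ^ 2 := by
    rw [hfail, Finset.sum_eq_single 0]
    · simp [hWcol]
    · intro c _ hc
      simp [hWcol, hc]
    · simp
  obtain ⟨a, ha⟩ := amplify_apply_of_good (a₀, 0) p z (W x y) l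
  have hamp := chebGain_mul_failure_le (a₀, 0) p hΓ hz (W x y) (by
    rw [hf0]; nlinarith) l
  set R := amplify (a₀, 0) p z (W x y) l with hR
  have hle : failure (a₀, 0) p R ≤ (1 + 9 ^ l * δ)⁻¹ := by
    have h1 := le_chebGain hΓ l
    rw [add_sub_cancel_left] at h1
    have h2 : 0 < 1 + 9 ^ l * δ := by positivity
    have h3 : 0 ≤ failure (a₀, 0) p R := Finset.sum_nonneg fun i _ => by split_ifs <;> positivity
    rw [← mul_one (_)⁻¹, ← div_eq_inv_mul, le_div_iff₀ h2]
    nlinarith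
  refine traceDist_pureState_le _ (fun (ω : Option M × Chan T) i => R.1 ((i, ω.1), ω.2) (a₀, 0))
    (hout x y) ?_ hg (Finset.univ.filter fun ω => ω.1 = none) ?_ ?_
  · rw [← sum_norm_sq_column R (a₀, 0), Fintype.sum_prod_type, Fintype.sum_prod_type_right]
    simp only [Fintype.sum_prod_type_right]
    rw [Finset.sum_comm]
  · rintro ⟨w, c⟩ hw
    obtain rfl : w = none := by simpa using hw
    refine ⟨if c = 0 then a else 0, fun i => ?_⟩
    rw [ha _ rfl, hWcol]
    split_ifs <;> simp
  · rw [Finset.sum_filter, Fintype.sum_prod_type, Fintype.sum_option]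
    simp only [if_true, reduceCtorEq, if_false, Finset.sum_const_zero, add_zero]
    rw [hfail] at hle
    linarith

/-! ### The linear regression protocols -/

theorem pureState_smul {n : ℕ} {c : ℝ} (hc : c ≠ 0) (v : Fin n → ℝ) :
    pureState (c • v) = pureState v := by
  have h : vecNorm (c • v) = |c| * vecNorm v := by
    rw [vecNorm, vecNorm, WithLp.toLp_smul, norm_smul, Real.norm_eq_abs]
  ext i j
  simp only [pureState, h, Pi.smul_apply, smul_eq_mul]
  congr 1
  rw [div_mul_div_comm, div_mul_div_comm, mul_mul_mul_comm, mul_mul_mul_comm |c|,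
    abs_mul_abs_self, mul_div_mul_left _ _ (mul_ne_zero hc hc)]

theorem vecNorm_eq_sqrt {n : ℕ} (v : Fin n → ℝ) : vecNorm v = √(∑ i, v i ^ 2) := by
  rw [← vecNorm_sq, Real.sqrt_sq (show 0 ≤ vecNorm v from norm_nonneg _)]

theorem exists_unitVector {M : Type*} [Fintype M] [DecidableEq M] [Nonempty M] (v : M → ℝ) :
    ∃ u : M → ℝ, ∑ μ, u μ ^ 2 = 1 ∧ (v ≠ 0 → u = (√(∑ μ, v μ ^ 2))⁻¹ • v) := by
  by_cases hv : v = 0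
  · exact ⟨Pi.single (Classical.arbitrary M) 1, by simp [Pi.single_apply], fun h => absurd hv h⟩
  · refine ⟨_, ?_, fun _ => rfl⟩
    obtain ⟨μ, hμ⟩ := Function.ne_iff.mp hv
    have hpos : 0 < ∑ μ, v μ ^ 2 :=
      Finset.sum_pos' (fun _ _ => sq_nonneg _) ⟨μ, Finset.mem_univ _, sq_pos_of_ne_zero hμ⟩
    simp only [Pi.smul_apply, smul_eq_mul, mul_pow, ← Finset.mul_sum, inv_pow]
    rw [Real.sq_sqrt hpos.le, inv_mul_cancel₀ hpos.ne']

theorem vecNorm_mulVec_le {m n : ℕ} (G : Matrix (Fin n) (Fin m) ℝ) (x : Fin m → ℝ) :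
    vecNorm (G.mulVec x) ≤ opNorm G * vecNorm x :=
  (LinearMap.toContinuousLinearMap (Matrix.toEuclideanLin G)).le_opNorm (WithLp.toLp 2 x)

theorem sum_sq_normalized_mulVec_le {m n : ℕ} (G : Matrix (Fin n) (Fin m) ℝ) (x : Fin m → ℝ) :
    ∑ i, (((opNorm G)⁻¹ • G).mulVec x i) ^ 2 ≤ ∑ j, x j ^ 2 := by
  have h0 : 0 ≤ opNorm G := norm_nonneg _
  rw [← vecNorm_sq, ← vecNorm_sq]
  refine pow_le_pow_left₀ (show 0 ≤ vecNorm _ from norm_nonneg _) ?_ 2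
  have h1 : vecNorm (((opNorm G)⁻¹ • G).mulVec x) = (opNorm G)⁻¹ * vecNorm (G.mulVec x) := by
    rw [Matrix.smul_mulVec, vecNorm, vecNorm, WithLp.toLp_smul, norm_smul,
      Real.norm_of_nonneg (inv_nonneg.mpr h0)]
  rw [h1]
  refine (mul_le_mul_of_nonneg_left (vecNorm_mulVec_le G x) (inv_nonneg.mpr h0)).trans ?_
  rw [← mul_assoc]
  have hx : 0 ≤ vecNorm x := norm_nonneg _
  exact mul_le_of_le_one_left hx (inv_mul_le_one)

/-- The success operator `A⁺ / ‖A⁺‖` maps `|b⟩` to a multiple of `A⁺b` with success probability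
`1 / opRatio²`. -/
theorem opNorm_normalized_mulVec {m n : ℕ} {A : InputA m n} {b u : Fin m → ℝ}
    (h : (pinv A).mulVec b ≠ 0) (hu : b ≠ 0 → u = (√(∑ i, b i ^ 2))⁻¹ • b) :
    (∃ c : ℝ, c ≠ 0 ∧ ((opNorm (pinv A))⁻¹ • pinv A).mulVec u = c • (pinv A).mulVec b) ∧
      ∑ i, (((opNorm (pinv A))⁻¹ • pinv A).mulVec u i) ^ 2 = (opRatio A b ^ 2)⁻¹ := by
  have hb : b ≠ 0 := by rintro rfl; exact h (Matrix.mulVec_zero _)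
  have hg := vecNorm_pos h
  have hb' := vecNorm_pos hb
  have hop : 0 < opNorm (pinv A) := by
    refine lt_of_le_of_ne (norm_nonneg _) fun h0 => ?_
    have := vecNorm_mulVec_le (pinv A) b
    rw [← h0, zero_mul] at this
    linarith
  have key : ((opNorm (pinv A))⁻¹ • pinv A).mulVec u =
      ((opNorm (pinv A))⁻¹ * (vecNorm b)⁻¹) • (pinv A).mulVec b := by
    rw [hu hb, ← vecNorm_eq_sqrt, Matrix.mulVec_smul, Matrix.smul_mulVec, smul_smul, mul_comm]
  refine ⟨⟨_, by positivity, key⟩, ?_⟩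
  rw [key]
  simp only [Pi.smul_apply, smul_eq_mul, mul_pow, ← Finset.mul_sum]
  rw [← vecNorm_sq, opRatio]
  field_simp

/-- Contracting the second index of the normalised vector of entries of `A⁺` with `|b⟩` gives a multiple
of `A⁺b`, with success probability `1 / frobRatio²`. -/
theorem frobNorm_normalized_mulVec {m n : ℕ} {A : InputA m n} {b u : Fin m → ℝ}
    {w : Fin n × Fin m → ℝ} (h : (pinv A).mulVec b ≠ 0)
    (hu : b ≠ 0 → u = (√(∑ i, b i ^ 2))⁻¹ • b)
    (hw : (fun q : Fin n × Fin m => pinv A q.1 q.2) ≠ 0 →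
      w = (√(∑ q : Fin n × Fin m, pinv A q.1 q.2 ^ 2))⁻¹ • fun q => pinv A q.1 q.2) :
    (∃ c : ℝ, c ≠ 0 ∧ (Matrix.of fun i (q : Fin n × Fin m) => if q.1 = i then u q.2 else 0).mulVec w
      = c • (pinv A).mulVec b) ∧
      ∑ i, ((Matrix.of fun i (q : Fin n × Fin m) => if q.1 = i then u q.2 else 0).mulVec w i) ^ 2 =
        (frobRatio A b ^ 2)⁻¹ := by
  have hb : b ≠ 0 := by rintro rfl; exact h (Matrix.mulVec_zero _)
  have hG : (fun q : Fin n × Fin m => pinv A q.1 q.2) ≠ 0 := by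
    intro h0
    apply h
    have : pinv A = 0 := by
      ext i j
      exact congrFun h0 (i, j)
    rw [this, Matrix.zero_mulVec]
  have hg := vecNorm_pos h
  have hb' := vecNorm_pos hb
  have hF : 0 < frobNorm (pinv A) := by
    obtain ⟨q, hq⟩ := Function.ne_iff.mp hG
    rw [frobNorm, ← Fintype.sum_prod_type']
    exact Real.sqrt_pos.mpr (Finset.sum_pos' (fun _ _ => sq_nonneg _)
      ⟨q, Finset.mem_univ _, sq_pos_of_ne_zero hq⟩)
  have key : (Matrix.of fun i (q : Fin n × Fin m) => if q.1 = i then u q.2 else 0).mulVec w =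
      ((frobNorm (pinv A))⁻¹ * (vecNorm b)⁻¹) • (pinv A).mulVec b := by
    have hfr : frobNorm (pinv A) = √(∑ q : Fin n × Fin m, pinv A q.1 q.2 ^ 2) := by
      rw [frobNorm, ← Fintype.sum_prod_type']
    rw [hu hb, hw hG, ← vecNorm_eq_sqrt, ← hfr]
    ext i
    simp only [Matrix.mulVec, dotProduct, Matrix.of_apply, Fintype.sum_prod_type, Pi.smul_apply,
      smul_eq_mul, Finset.mul_sum]
    rw [Finset.sum_eq_single i]
    · simp only [if_true]
      exact Finset.sum_congr rfl fun j _ => by ring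
    · intro i' _ hi'
      simp [hi']
    · simp
  refine ⟨⟨_, by positivity, key⟩, ?_⟩
  rw [key]
  simp only [Pi.smul_apply, smul_eq_mul, mul_pow, ← Finset.mul_sum]
  rw [← vecNorm_sq, frobRatio]
  field_simp

theorem sum_sq_contract_le {m n : ℕ} {u : Fin m → ℝ} (hu : ∑ j, u j ^ 2 = 1)
    (x : Fin n × Fin m → ℝ) :
    ∑ i, ((Matrix.of fun i (q : Fin n × Fin m) => if q.1 = i then u q.2 else 0).mulVec x i) ^ 2 ≤
      ∑ q, x q ^ 2 := by
  rw [Fintype.sum_prod_type]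
  refine Finset.sum_le_sum fun i _ => ?_
  simp only [Matrix.mulVec, dotProduct, Matrix.of_apply, Fintype.sum_prod_type]
  rw [Finset.sum_eq_single i]
  · simp only [if_true]
    refine (Finset.sum_mul_sq_le_sq_mul_sq _ _ _).trans ?_
    rw [hu, one_mul]
  · intro i' _ hi'
    simp [hi']
  · simp

theorem pow_failure_le {p K ε : ℝ} (hε : 0 < ε) (hK : 0 < K) (hp : K⁻¹ ≤ p) (hp1 : p ≤ 1) :
    (1 - p) ^ ⌈K / ε⌉₊ ≤ ε := by
  have h1 : (1 - p) ^ ⌈K / ε⌉₊ ≤ Real.exp (-p) ^ ⌈K / ε⌉₊ :=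
    pow_le_pow_left₀ (by linarith) (Real.one_sub_le_exp_neg p) _
  refine h1.trans ?_
  rw [← Real.exp_nat_mul, mul_neg, Real.exp_neg]
  have h2 : ε⁻¹ ≤ ⌈K / ε⌉₊ * p := by
    calc ε⁻¹ = (K / ε) * K⁻¹ := by field_simp
      _ ≤ ⌈K / ε⌉₊ * p := mul_le_mul (Nat.le_ceil _) hp (by positivity) (by positivity)
  refine inv_le_of_inv_le₀ hε ?_
  -- `exp (-1 / ε) ≤ ε`, since `exp (1 / ε) ≥ 1 / ε`.
  have h3 := Real.add_one_le_exp (⌈K / ε⌉₊ * p)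
  linarith

theorem exists_embedding_chan {M : Type*} [Fintype M] {T : ℕ} (h : Fintype.card M ≤ 2 ^ T) :
    Nonempty (M ↪ Chan T) :=
  Function.Embedding.nonempty_of_card_le (by simpa using h)

section Protocols

variable {m n : ℕ}

theorem exists_bobToAlice_copies (hm : 1 ≤ m) (hn : 1 ≤ n) {t : ℕ} (ht : m ≤ 2 ^ t) {K ε : ℝ}
    (hK : 1 ≤ K) (hε : 0 < ε) :
    ∃ P : Protocol (InputA m n) (InputB m) n, Model.bobToAlice.Admits P ∧
      P.cost = ⌈K / ε⌉₊ * t ∧ ∀ A b, (pinv A).mulVec b ≠ 0 → opRatio A b ^ 2 ≤ K →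
        traceDist (P.output A b) (pureState ((pinv A).mulVec b)) ≤ ε := by
  have : Nonempty (Fin m) := ⟨⟨0, hm⟩⟩
  obtain ⟨code⟩ := exists_embedding_chan (M := Fin ⌈K / ε⌉₊ → Fin m) (T := ⌈K / ε⌉₊ * t) (by
    rw [Fintype.card_fun, Fintype.card_fin, Fintype.card_fin, mul_comm, pow_mul]
    exact Nat.pow_le_pow_left ht _)
  choose u hu hu' using fun b : InputB m => exists_unitVector b
  obtain ⟨σ, hσ⟩ := OneWayScheme.exists_copies (n := n) ⟨0, hn⟩ code u hu
    (fun A : InputA m n => (opNorm (pinv A))⁻¹ • pinv A) (fun A => sum_sq_normalized_mulVec_le _)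
  obtain ⟨P, hP, hreal⟩ := σ.exists_protocol_bobToAlice ⟨0, hn⟩
  refine ⟨P, hP, hreal.1, fun A b h hr => ?_⟩
  obtain ⟨⟨c, hc, hcv⟩, hsum⟩ := opNorm_normalized_mulVec h (hu' b)
  have hs := hσ b A
  have hpos : 0 < opRatio A b ^ 2 := by
    rw [← inv_pos, ← hsum, ← vecNorm_sq, hcv]
    exact pow_pos (vecNorm_pos (smul_ne_zero hc h)) 2
  have hle := sum_sq_normalized_mulVec_le (pinv A) (u b)
  rw [hu, hsum] at hle
  rw [← pureState_smul hc, ← hcv]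
  refine (hreal.traceDist_le (by rw [hcv]; exact smul_ne_zero hc h) hs).trans ?_
  rw [hsum]
  exact pow_failure_le hε (by linarith) (inv_anti₀ hpos hr) hle

theorem exists_aliceToBob_copies (hm : 1 ≤ m) (hn : 1 ≤ n) {t : ℕ} (ht : m * n ≤ 2 ^ t) {K ε : ℝ}
    (hK : 1 ≤ K) (hε : 0 < ε) :
    ∃ P : Protocol (InputA m n) (InputB m) n, Model.aliceToBob.Admits P ∧
      P.cost = ⌈K / ε⌉₊ * t ∧ ∀ A b, (pinv A).mulVec b ≠ 0 → frobRatio A b ^ 2 ≤ K →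
        traceDist (P.output A b) (pureState ((pinv A).mulVec b)) ≤ ε := by
  have : Nonempty (Fin m) := ⟨⟨0, hm⟩⟩
  have : Nonempty (Fin n) := ⟨⟨0, hn⟩⟩
  obtain ⟨code⟩ := exists_embedding_chan (M := Fin ⌈K / ε⌉₊ → Fin n × Fin m)
    (T := ⌈K / ε⌉₊ * t) (by
    rw [Fintype.card_fun, Fintype.card_prod, Fintype.card_fin, Fintype.card_fin, Fintype.card_fin,
      mul_comm n, mul_comm _ t, pow_mul]
    exact Nat.pow_le_pow_left ht _)
  choose u hu hu' using fun b : InputB m => exists_unitVector b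
  choose w hw hw' using fun A : InputA m n =>
    exists_unitVector fun q : Fin n × Fin m => pinv A q.1 q.2
  obtain ⟨σ, hσ⟩ := OneWayScheme.exists_copies (n := n) ⟨0, hn⟩ code w hw
    (fun b : InputB m => Matrix.of fun i (q : Fin n × Fin m) => if q.1 = i then u b q.2 else 0)
    (fun b => sum_sq_contract_le (hu b))
  obtain ⟨P, hP, hreal⟩ := σ.exists_protocol_aliceToBob ⟨0, hn⟩
  refine ⟨P, hP, hreal.1, fun A b h hr => ?_⟩
  obtain ⟨⟨c, hc, hcv⟩, hsum⟩ := frobNorm_normalized_mulVec h (hu' b) (hw' A)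
  have hs := hσ A b
  have hpos : 0 < frobRatio A b ^ 2 := by
    rw [← inv_pos, ← hsum, ← vecNorm_sq, hcv]
    exact pow_pos (vecNorm_pos (smul_ne_zero hc h)) 2
  have hle := sum_sq_contract_le (n := n) (hu b) (w A)
  rw [hw, hsum] at hle
  rw [← pureState_smul hc, ← hcv]
  refine (hreal.traceDist_le (by rw [hcv]; exact smul_ne_zero hc h) hs).trans ?_
  rw [hsum]
  exact pow_failure_le hε (by linarith) (inv_anti₀ hpos hr) hle

theorem exists_twoWay_amplify (hm : 1 ≤ m) (hn : 1 ≤ n) {t : ℕ} (ht : m ≤ 2 ^ t) {K ε : ℝ}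
    (hK : 1 ≤ K) (l : ℕ) (hl : (1 + 9 ^ l * (K ^ 2)⁻¹)⁻¹ ≤ ε) :
    ∃ P : Protocol (InputA m n) (InputB m) n, P.cost = 2 * 3 ^ l * t ∧
      ∀ A b, (pinv A).mulVec b ≠ 0 → opRatio A b ≤ K →
        traceDist (P.output A b) (pureState ((pinv A).mulVec b)) ≤ ε := by
  have : Nonempty (Fin m) := ⟨⟨0, hm⟩⟩
  obtain ⟨code⟩ := exists_embedding_chan (M := Fin m) (T := t) (by simpa using ht)
  choose u hu hu' using fun b : InputB m => exists_unitVector b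
  obtain ⟨P, hP, hout⟩ := exists_protocol_amplify (n := n) ⟨0, hn⟩ code u hu
    (fun A : InputA m n => (opNorm (pinv A))⁻¹ • pinv A) (fun A => sum_sq_normalized_mulVec_le _)
    (δ := (K ^ 2)⁻¹) (by positivity) l
  refine ⟨P, hP, fun A b h hr => ?_⟩
  obtain ⟨⟨c, hc, hcv⟩, hsum⟩ := opNorm_normalized_mulVec h (hu' b)
  have hpos : 0 < opRatio A b ^ 2 := by
    rw [← inv_pos, ← hsum, ← vecNorm_sq, hcv]
    exact pow_pos (vecNorm_pos (smul_ne_zero hc h)) 2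
  have h0 : 0 ≤ opRatio A b :=
    div_nonneg (mul_nonneg (norm_nonneg _) (norm_nonneg _)) (norm_nonneg _)
  have := hout A b (by rw [hcv]; exact smul_ne_zero hc h) (by
    rw [hsum]
    exact inv_anti₀ hpos (pow_le_pow_left₀ h0 hr 2))
  rw [hcv, pureState_smul hc] at this
  exact this.trans hl

theorem exists_bobToAlice_exact {k : ℕ} (hn : 1 ≤ n) (dec : (Fin k → Bool) → ℝ) :
    ∃ P : Protocol (InputA m n) (InputB m) n, Model.bobToAlice.Admits P ∧ P.cost = m * k ∧
      ∀ A b, Instance dec A b → traceDist (P.output A b) (pureState ((pinv A).mulVec b)) ≤ 0 := by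
  obtain ⟨code⟩ := exists_embedding_chan (M := Fin m → Fin k → Bool) (T := m * k) (by
    simp [← pow_mul, mul_comm])
  obtain ⟨σ, hσ⟩ := OneWayScheme.exists_exact (n := n) ⟨0, hn⟩ code
    (fun (b : InputB m) i => Function.invFun dec (b i))
    (fun (A : InputA m n) μ => (pinv A).mulVec fun i => dec (μ i))
  obtain ⟨P, hP, hreal⟩ := σ.exists_protocol_bobToAlice ⟨0, hn⟩
  refine ⟨P, hP, hreal.1, fun A b h => ?_⟩
  have hb : (fun i => dec (Function.invFun dec (b i))) = b :=
    funext fun i => Function.invFun_eq (h.2.1 i)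
  have hs := hσ b A
  rw [hb] at hs
  exact hreal.traceDist_le h.2.2 (hs h.2.2)

theorem exists_aliceToBob_exact {k : ℕ} (hn : 1 ≤ n) (dec : (Fin k → Bool) → ℝ) :
    ∃ P : Protocol (InputA m n) (InputB m) n, Model.aliceToBob.Admits P ∧ P.cost = m * n * k ∧
      ∀ A b, Instance dec A b → traceDist (P.output A b) (pureState ((pinv A).mulVec b)) ≤ 0 := by
  obtain ⟨code⟩ := exists_embedding_chan (M := Fin m → Fin n → Fin k → Bool) (T := m * n * k) (by
    simp only [Fintype.card_fun, Fintype.card_bool, Fintype.card_fin, ← pow_mul]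
    exact le_of_eq (congrArg _ (by ring)))
  obtain ⟨σ, hσ⟩ := OneWayScheme.exists_exact (n := n) ⟨0, hn⟩ code
    (fun (A : InputA m n) i j => Function.invFun dec (A i j))
    (fun (b : InputB m) μ => (pinv (Matrix.of fun i j => dec (μ i j))).mulVec b)
  obtain ⟨P, hP, hreal⟩ := σ.exists_protocol_aliceToBob ⟨0, hn⟩
  refine ⟨P, hP, hreal.1, fun A b h => ?_⟩
  have hA : (Matrix.of fun i j => dec (Function.invFun dec (A i j))) = A := by
    ext i j
    exact Function.invFun_eq (h.1 i j)
  have hs := hσ A b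
  rw [hA] at hs
  exact hreal.traceDist_le h.2.2 (hs h.2.2)

/-- For `m = 1` the state `|A⁺b⟩` depends on `A` only. -/
theorem exists_bobToAlice_free (hn : 1 ≤ n) :
    ∃ P : Protocol (InputA 1 n) (InputB 1) n, Model.bobToAlice.Admits P ∧ P.cost = 0 ∧
      ∀ A b, (pinv A).mulVec b ≠ 0 →
        traceDist (P.output A b) (pureState ((pinv A).mulVec b)) ≤ 0 := by
  obtain ⟨code⟩ := exists_embedding_chan (M := Unit) (T := 0) (by simp)
  obtain ⟨σ, hσ⟩ := OneWayScheme.exists_exact (n := n) ⟨0, hn⟩ code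
    (fun _ : InputB 1 => ()) (fun (A : InputA 1 n) _ => fun i => pinv A i 0)
  obtain ⟨P, hP, hreal⟩ := σ.exists_protocol_bobToAlice ⟨0, hn⟩
  refine ⟨P, hP, hreal.1, fun A b h => ?_⟩
  have hv : (pinv A).mulVec b = b 0 • fun i => pinv A i 0 := by
    ext i
    simp [Matrix.mulVec, dotProduct, mul_comm]
  rw [hv] at h ⊢
  obtain ⟨h1, h2⟩ := smul_ne_zero_iff.mp h
  rw [pureState_smul h1]
  exact hreal.traceDist_le h2 (hσ b A h2)

/-- For `m = n = 1` there is only one state to output. -/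
theorem exists_aliceToBob_free :
    ∃ P : Protocol (InputA 1 1) (InputB 1) 1, Model.aliceToBob.Admits P ∧ P.cost = 0 ∧
      ∀ A b, (pinv A).mulVec b ≠ 0 →
        traceDist (P.output A b) (pureState ((pinv A).mulVec b)) ≤ 0 := by
  obtain ⟨code⟩ := exists_embedding_chan (M := Unit) (T := 0) (by simp)
  obtain ⟨σ, hσ⟩ := OneWayScheme.exists_exact (n := 1) 0 code
    (fun _ : InputA 1 1 => ()) (fun (_ : InputB 1) _ => fun _ => 1)
  obtain ⟨P, hP, hreal⟩ := σ.exists_protocol_aliceToBob 0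
  refine ⟨P, hP, hreal.1, fun A b h => ?_⟩
  have hv : (pinv A).mulVec b = (pinv A).mulVec b 0 • fun _ => 1 := by
    ext i
    rw [Subsingleton.elim i 0]
    simp
  rw [hv] at h ⊢
  obtain ⟨h1, h2⟩ := smul_ne_zero_iff.mp h
  rw [pureState_smul h1]
  exact hreal.traceDist_le h2 (hσ A b h2)

theorem quantumCC_le {M : Model} {D : InputA m n → InputB m → Prop} {ε r : ℝ}
    {P : Protocol (InputA m n) (InputB m) n} (hM : M.Admits P) (hP : OutputsSolution P D ε)
    (hr : (P.cost : ℝ) ≤ r) :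
    ((quantumCC M D ε : ℕ∞) : ℝ≥0∞) ≤ ENNReal.ofReal r := by
  have h1 : quantumCC M D ε ≤ P.cost := iInf_le_of_le P (iInf₂_le_of_le hM hP le_rfl)
  refine (ENat.toENNReal_le.mpr h1).trans ?_
  rw [ENat.toENNReal_coe, ← ENNReal.ofReal_natCast]
  exact ENNReal.ofReal_le_ofReal hr

end Protocols

theorem exists_qubits {d : ℕ} (hd : 2 ≤ d) :
    ∃ t : ℕ, d ≤ 2 ^ t ∧ (t : ℝ) ≤ 2 / Real.log 2 * Real.log d := by
  refine ⟨Nat.log 2 d + 1, (Nat.lt_pow_succ_log_self one_lt_two d).le, ?_⟩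
  have hl : 0 < Real.log 2 := Real.log_pos one_lt_two
  have h1 : Real.log 2 ≤ Real.log d := Real.log_le_log two_pos (by exact_mod_cast hd)
  have h2 : (Nat.log 2 d : ℝ) * Real.log 2 ≤ Real.log d := by
    rw [← Real.log_pow]
    exact Real.log_le_log (by positivity) (by exact_mod_cast Nat.pow_log_le_self 2 (by omega))
  rw [div_mul_eq_mul_div, le_div_iff₀ hl]
  push_cast
  linarith

theorem le_ofReal_mul_min {x : ℝ≥0∞} {C a b : ℝ} (ha : x ≤ ENNReal.ofReal (C * a))
    (hb : x ≤ ENNReal.ofReal (C * b)) : x ≤ ENNReal.ofReal (C * min a b) := by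
  rcases min_choice a b with h | h <;> rwa [h]

theorem ceil_mul_qubits_le {K ε L : ℝ} {t : ℕ} (hK : 1 ≤ K) (hε : 0 < ε)
    (ht : (t : ℝ) ≤ 2 / Real.log 2 * L) :
    ((⌈K / ε⌉₊ * t : ℕ) : ℝ) ≤ 2 * (1 + ε⁻¹) / Real.log 2 * (L * K) := by
  have h1 : (⌈K / ε⌉₊ : ℝ) ≤ (1 + ε⁻¹) * K := by
    have := (Nat.ceil_lt_add_one (show 0 ≤ K / ε by positivity)).le
    rw [div_eq_mul_inv] at this ⊢
    linarith
  push_cast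
  calc (⌈K / ε⌉₊ : ℝ) * t ≤ ((1 + ε⁻¹) * K) * (2 / Real.log 2 * L) :=
        mul_le_mul h1 ht (by positivity) (by positivity)
    _ = _ := by ring

/-- The number of amplification steps: `3 ^ l` is the first power of `3` above `(1 + 1 / ε) K`. -/
theorem exists_rounds {K ε : ℝ} (hK : 1 ≤ K) (hε : 0 < ε) :
    ∃ l : ℕ, (1 + 9 ^ l * (K ^ 2)⁻¹)⁻¹ ≤ ε ∧ (3 : ℝ) ^ l ≤ 3 * ((1 + ε⁻¹) * K) := by
  have hε' : 0 < ε⁻¹ := inv_pos.mpr hε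
  have hE : 1 ≤ (1 + ε⁻¹) * K := by nlinarith
  obtain ⟨l, hl1, hl2⟩ := exists_nat_pow_near hE (by norm_num : (1 : ℝ) < 3)
  refine ⟨l + 1, inv_le_of_inv_le₀ hε ?_, by rw [pow_succ]; linarith⟩
  have h1 : ((1 + ε⁻¹) * K) ^ 2 ≤ 9 ^ (l + 1) := by
    have := pow_le_pow_left₀ (by linarith) hl2.le 2
    rwa [← pow_mul, mul_comm (l + 1), pow_mul, show (3 : ℝ) ^ 2 = 9 by norm_num] at this
  have h2 : (1 + ε⁻¹) ^ 2 ≤ 9 ^ (l + 1) * (K ^ 2)⁻¹ := by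
    rw [← div_eq_mul_inv, le_div_iff₀ (by positivity), ← mul_pow]
    exact h1
  nlinarith

theorem bits_le {c d : ℝ} {k : ℕ} (hd : 2 ≤ d) (hk : (k : ℝ) ≤ c * (1 + Real.log d)) :
    (k : ℝ) ≤ |c| * (1 + (Real.log 2)⁻¹) * Real.log d := by
  have hl : 0 < Real.log 2 := Real.log_pos one_lt_two
  have h1 : Real.log 2 ≤ Real.log d := Real.log_le_log two_pos hd
  have h2 : 1 ≤ (Real.log 2)⁻¹ * Real.log d := by
    rw [← div_eq_inv_mul, le_div_iff₀ hl, one_mul]; exact h1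
  calc (k : ℝ) ≤ c * (1 + Real.log d) := hk
    _ ≤ |c| * (1 + Real.log d) := mul_le_mul_of_nonneg_right (le_abs_self c) (by linarith)
    _ ≤ |c| * ((1 + (Real.log 2)⁻¹) * Real.log d) :=
        mul_le_mul_of_nonneg_left (by linarith) (abs_nonneg c)
    _ = _ := by ring

end QRegression

end

theorem mainTheorem1 (c ε : ℝ) (hε : 0 < ε) :
    ∃ C : ℝ, 0 < C ∧
      ∀ (m n : ℕ) (_ : 1 ≤ m) (_ : 1 ≤ n)
        (k : ℕ) (_ : (k : ℝ) ≤ c * (1 + Real.log ((m : ℝ) * n)))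
        (dec : (Fin k → Bool) → ℝ) (K : ℝ) (_ : 1 ≤ K),
        ((QRegression.quantumCC (m := m) (n := n) .bobToAlice
            (fun A b => QRegression.Instance dec A b ∧ QRegression.opRatio A b ^ 2 ≤ K) ε :
              ℕ∞) : ℝ≥0∞)
          ≤ ENNReal.ofReal (C * min (Real.log m * K) (m * Real.log ((m : ℝ) * n))) ∧
        ((QRegression.quantumCC (m := m) (n := n) .aliceToBob
            (fun A b => QRegression.Instance dec A b ∧ QRegression.frobRatio A b ^ 2 ≤ K) ε :
              ℕ∞) : ℝ≥0∞)
          ≤ ENNReal.ofReal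
              (C * min (Real.log ((m : ℝ) * n) * K) ((m : ℝ) * n * Real.log ((m : ℝ) * n))) ∧
        ((QRegression.quantumCC (m := m) (n := n) .twoWay
            (fun A b => QRegression.Instance dec A b ∧ QRegression.opRatio A b ≤ K) ε :
              ℕ∞) : ℝ≥0∞)
          ≤ ENNReal.ofReal (C * min (Real.log m * K) (m * Real.log ((m : ℝ) * n))) := by
  open QRegression in
  have hl2 : 0 < Real.log 2 := Real.log_pos one_lt_two
  have hε' : 0 < ε⁻¹ := inv_pos.mpr hε
  set C₁ : ℝ := |c| * (1 + (Real.log 2)⁻¹) with hC₁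
  set C₂ : ℝ := 2 * (1 + ε⁻¹) / Real.log 2 with hC₂
  have hC₁0 : 0 ≤ C₁ := by positivity
  have hC₂0 : 0 < C₂ := by positivity
  -- `C₁` bounds the exact protocols; `C₂` bounds the one-way protocols and `6 * C₂` the two-way one,
  -- which has at most `3 (1 + 1 / ε) K` rounds of two messages each.
  refine ⟨C₁ + 6 * C₂, by positivity, fun m n hm hn k hk dec K hK => ?_⟩
  have hm' : (1 : ℝ) ≤ m := by exact_mod_cast hm
  have hn' : (1 : ℝ) ≤ n := by exact_mod_cast hn
  have hmn' : (1 : ℝ) ≤ (m : ℝ) * n := one_le_mul_of_one_le_of_one_le hm' hn'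
  have hlm := Real.log_nonneg hm'
  have hlmn := Real.log_nonneg hmn'
  have hCle : ∀ {x y : ℝ}, x ≤ C₁ * y → 0 ≤ y → x ≤ (C₁ + 6 * C₂) * y := fun h hy =>
    h.trans (mul_le_mul_of_nonneg_right (by linarith) hy)
  have hCle' : ∀ {x y : ℝ}, x ≤ 6 * C₂ * y → 0 ≤ y → x ≤ (C₁ + 6 * C₂) * y := fun h hy =>
    h.trans (mul_le_mul_of_nonneg_right (by linarith) hy)
  have hC : 0 ≤ C₁ + 6 * C₂ := by linarith
  have part₂ : ((quantumCC (m := m) (n := n) .aliceToBob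
      (fun A b => Instance dec A b ∧ frobRatio A b ^ 2 ≤ K) ε : ℕ∞) : ℝ≥0∞)
      ≤ ENNReal.ofReal ((C₁ + 6 * C₂) *
        min (Real.log ((m : ℝ) * n) * K) ((m : ℝ) * n * Real.log ((m : ℝ) * n))) := by
    by_cases hmn : m = 1 ∧ n = 1
    · obtain ⟨rfl, rfl⟩ := hmn
      obtain ⟨P, hP, hcost, hout⟩ := exists_aliceToBob_free
      refine quantumCC_le hP (fun A b h => (hout A b h.1.2.2).trans hε.le) ?_
      rw [hcost, Nat.cast_zero]
      positivity
    have hmn2 : 2 ≤ m * n := by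
      by_contra h
      have h1 : m ≤ m * n := Nat.le_mul_of_pos_right m hn
      have h2 : n ≤ m * n := Nat.le_mul_of_pos_left n hm
      exact hmn ⟨by omega, by omega⟩
    have hmn2' : (2 : ℝ) ≤ (m : ℝ) * n := by exact_mod_cast hmn2
    refine le_ofReal_mul_min ?_ ?_
    · obtain ⟨t, ht, ht'⟩ := exists_qubits hmn2
      rw [Nat.cast_mul] at ht'
      obtain ⟨P, hP, hcost, hout⟩ := exists_aliceToBob_copies hm hn ht hK hε
      refine quantumCC_le hP (fun A b h => hout A b h.1.2.2 h.2) ?_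
      rw [hcost]
      refine hCle' ((ceil_mul_qubits_le hK hε ht').trans ?_) (by positivity)
      exact mul_le_mul_of_nonneg_right (by linarith) (by positivity)
    · obtain ⟨P, hP, hcost, hout⟩ := exists_aliceToBob_exact (m := m) hn dec
      refine quantumCC_le hP (fun A b h => (hout A b h.1).trans hε.le) ?_
      rw [hcost]
      refine hCle ?_ (by positivity)
      push_cast
      rw [mul_left_comm]
      exact mul_le_mul_of_nonneg_left (bits_le hmn2' hk) (by positivity)
  obtain rfl | hm2 : m = 1 ∨ 2 ≤ m := by omega
  · obtain ⟨P, hP, hcost, hout⟩ := exists_bobToAlice_free hn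
    refine ⟨quantumCC_le hP (fun A b h => (hout A b h.1.2.2).trans hε.le) ?_, part₂,
      quantumCC_le (P := P) trivial (fun A b h => (hout A b h.1.2.2).trans hε.le) ?_⟩ <;>
    · rw [hcost, Nat.cast_zero]
      positivity
  have hmn2' : (2 : ℝ) ≤ (m : ℝ) * n := by
    have : (2 : ℝ) ≤ m := by exact_mod_cast hm2
    nlinarith
  obtain ⟨t, ht, ht'⟩ := exists_qubits hm2
  obtain ⟨E, hE, hEcost, hEout⟩ := exists_bobToAlice_exact (m := m) hn dec
  have hEle : (E.cost : ℝ) ≤ (C₁ + 6 * C₂) * (m * Real.log ((m : ℝ) * n)) := by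
    rw [hEcost]
    refine hCle ?_ (by positivity)
    push_cast
    rw [mul_left_comm]
    exact mul_le_mul_of_nonneg_left (bits_le hmn2' hk) (by positivity)
  refine ⟨le_ofReal_mul_min ?_ ?_, part₂, le_ofReal_mul_min ?_ ?_⟩
  · obtain ⟨P, hP, hcost, hout⟩ := exists_bobToAlice_copies hm hn ht hK hε
    refine quantumCC_le hP (fun A b h => hout A b h.1.2.2 h.2) ?_
    rw [hcost]
    refine hCle' ((ceil_mul_qubits_le hK hε ht').trans ?_) (by positivity)
    exact mul_le_mul_of_nonneg_right (by linarith) (by positivity)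
  · exact quantumCC_le hE (fun A b h => (hEout A b h.1).trans hε.le) hEle
  · obtain ⟨l, hl, hl'⟩ := exists_rounds hK hε
    obtain ⟨P, hcost, hout⟩ := exists_twoWay_amplify hm hn ht hK l hl
    refine quantumCC_le (P := P) trivial (fun A b h => hout A b h.1.2.2 h.2) ?_
    rw [hcost]
    refine hCle' ?_ (by positivity)
    push_cast
    calc (2 * 3 ^ l * t : ℝ) ≤ (2 * (3 * ((1 + ε⁻¹) * K))) * (2 / Real.log 2 * Real.log m) :=
          mul_le_mul (by linarith) ht' (by positivity) (by positivity)
      _ = 6 * C₂ * (Real.log m * K) := by rw [hC₂]; ring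
  · exact quantumCC_le (P := E) trivial (fun A b h => (hEout A b h.1).trans hε.le) hEle
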